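/- Let $r\ge 1$ and let $p_1=0,p_2,\dots,p_{r+1}$ be Laurent series in $t$ with complex coefficients and finitely many negative exponents, convergent for $0<|t|$ small. Write $d(p)$ for the lowest exponent of $p$ with nonzero coefficient, and write $q<p$ if $p\ne q$ and the coefficient of $q$ at the exponent $d(p-q)$ is zero. Assume $p_1<p_2<\cdots<p_{r+1}$. For small $t\neq 0$ let $C_t\subset\mathbb P^{r+1}$ be the line $X_1+X_i-p_i(t)=0$ ($2\le i\le r+1$), with the affine coordinate $\zeta=X_1$ and marked at its intersections $\zeta=p_1(t),\dots,p_{r+1}(t),\infty$ with the toric divisors. Let $(\Gamma_v,h_v)$ be a $3$-valent embedded tropical curve in $\mathbb R^{r+1}$, with all edge weights $1$, whose image is the tropicalization of the line, i.e. the intersection of the tropical hyperplanes given by the $(\min,+)$-polynomials $X_i\oplus X_j\oplus d(p_i-p_j)$, $i\neq j$, which tropicalize the equations $X_1+X_j-p_j=0$ and $X_i-X_j-p_i+p_j=0$ of the line. Its unbounded edges have the directions $e_1,\dots,e_{r+1}$ and $f=-\sum_j e_j$. Let $D$ be a pre-log curve of type $(\Gamma_v,h_v)$: a nodal curve with one component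 $\mathbb P^1$ for each vertex, with a marked point for each edge at that vertex, the two points of each bounded edge being glued to a node, together with torically transverse maps of the components which meet precisely the toric divisors of the adjacent edges, at the marked points and with multiplicity the weight, and which agree at the nodes. For such a marked curve $C$ with toric coordinates $X_1,\dots,X_{r+1}$, let $\Gamma(C,\mathcal N^\vee\otimes\omega)$ be the complex vector space of local dual obstruction sections, where $\mathcal N=(N\otimes\mathcal O_C)/\Theta_C$ is the log normal sheaf, $N=\mathbb Z^{r+1}$, and all marked points are treated as nodes of an ambient curve: its elements are the families $\sum_i e_i^\vee\otimes\omega_i$ of $N^\vee_{\mathbb C}$-valued meromorphic $1$-forms on the components, with at most logarithmic poles at the marked points and no other poles, with opposite residues on the two branches of each node inside $C$, and with $\sum_i\omega_i\otimes d\log X_i=0$ on each component. Then there is $\varepsilon>0$ such that for all $0<|t|<\varepsilon$ there are (non-canonical) linear isomorphisms $$\Theta_t\colon \Gamma(D,\mathcal N^\vee\otimes\omega)\xrightarrow{\ \sim\ }\Gamma(C_t,\mathcal N^\vee\otimes\omega),$$ which can be chosen to be compatible with residues modulo terms of order $t$: for every section $s$ of the left hand side there is a constant $K$ such that for all $0<|t|<\varepsilon$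 and for each direction $e_j$ (respectively $f$), each component of the $N^\vee_{\mathbb C}$-valued residue of $\Theta_t(s)$ at $\zeta=p_j(t)$ (respectively $\zeta=\infty$) differs by at most $K|t|$ from the corresponding component of the residue of $s$ at the marked point of the unbounded edge of $\Gamma_v$ of that direction. -/

import Mathlib

open scoped OnePoint RatFunc

noncomputable section

namespace TropLine

/-! ### Convergent Laurent series and their partial order -/

/-- The Laurent series `q` converges on some punctured disc around `0`. -/
def Converges (q : LaurentSeries ℂ) : Prop :=
  ∃ ε : ℝ, 0 < ε ∧ ∀ t : ℂ, 0 < ‖t‖ → ‖t‖ < ε → Summable fun k : ℤ => q.coeff k * t ^ k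

/-- The value of a convergent Laurent series at a small nonzero `t`. -/
def value (q : LaurentSeries ℂ) (t : ℂ) : ℂ := ∑' k : ℤ, q.coeff k * t ^ k

/-- `Prec q p` means `q < p`: at the lowest exponent where `p` and `q` differ, the coefficient
of `q` vanishes (so the lowest order term of `p - q` is a term of `p`). -/
def Prec (q p : LaurentSeries ℂ) : Prop :=
  ∃ j : ℤ, (∀ k < j, p.coeff k = q.coeff k) ∧ p.coeff j ≠ 0 ∧ q.coeff j = 0

/-! ### Tropicalization of the line `X₁ + Xᵢ - pᵢ = 0` -/

/-- The minimum of three real numbers is attained at least twice. -/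
def MinAttainedTwice (a b c : ℝ) : Prop :=
  (a = b ∧ a ≤ c) ∨ (a = c ∧ a ≤ b) ∨ (b = c ∧ b ≤ a)

/-- The tropicalization of the line `X_0 + X_i = p_i` (`i ≥ 1`, with `p_0 = 0`), `(min, +)`
convention: the intersection of the tropical hyperplanes `X_i ⊕ X_j ⊕ d(p_i - p_j)` of the
three-term equations `X_0 + X_j - p_j = 0` and `X_i - X_j - p_i + p_j = 0` of the line. -/
def tropLine {m : ℕ} (p : Fin m → LaurentSeries ℂ) : Set (Fin m → ℝ) :=
  {x | ∀ i j, i ≠ j → MinAttainedTwice (x i) (x j) ((p i - p j).order : ℝ)}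

/-! ### Graphs with unbounded edges, and tropical curves -/

/-- A graph with unbounded edges, given by its vertices `V` and its flags `F`. The flag `f` sits at
the vertex `vert f`; if `opp f ≠ f`, then `f` and `opp f` are the two flags of a bounded edge, and if
`opp f = f`, then `f` is the flag of an unbounded edge. -/
structure FlagGraph (V F : Type*) where
  vert : F → V
  opp : F → F
  opp_opp : ∀ f, opp (opp f) = f

open Classical in
/-- A parametrized tropical curve in `ℝⁿ` none of whose edges is contracted: vertices `v` are
placed at `pos v`, the edge of the flag `f` leaves `pos (vert f)` in the primitive integral direction
`dir f`, has weight `wt f`, and, if it is bounded, has lattice length `len f`. -/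
structure TropicalCurve (n : ℕ) (V F : Type*) [Fintype V] [Fintype F] extends FlagGraph V F where
  connected : ∀ v w : V,
    Relation.ReflTransGen (fun a b => ∃ f, vert f = a ∧ vert (opp f) = b) v w
  pos : V → Fin n → ℝ
  pos_rational : ∀ v i, ∃ q : ℚ, pos v i = (q : ℝ)
  dir : F → Fin n → ℤ
  dir_primitive : ∀ f, Finset.univ.gcd (dir f) = 1
  wt : F → ℕ
  wt_pos : ∀ f, 0 < wt f
  wt_opp : ∀ f, wt (opp f) = wt f
  len : F → ℝ
  len_pos : ∀ f, opp f ≠ f → 0 < len f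
  dir_opp : ∀ f, opp f ≠ f → ∀ i, dir (opp f) i = - dir f i
  pos_opp : ∀ f, opp f ≠ f → ∀ i, pos (vert (opp f)) i = pos (vert f) i + len f * (dir f i : ℝ)
  balanced : ∀ (v : V) (i : Fin n),
    ∑ f with vert f = v, (wt f : ℤ) * dir f i = 0

namespace TropicalCurve

variable {n : ℕ} {V F : Type*} [Fintype V] [Fintype F]

/-- The image in `ℝⁿ` of the interior of the edge of the flag `f` (an open segment for a bounded
edge, an open ray for an unbounded one). -/
def openEdge (Γ : TropicalCurve n V F) (f : F) : Set (Fin n → ℝ) :=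
  {x | ∃ s : ℝ, 0 < s ∧ (Γ.opp f ≠ f → s < Γ.len f) ∧
    ∀ i, x i = Γ.pos (Γ.vert f) i + s * (Γ.dir f i : ℝ)}

/-- The image of the tropical curve in `ℝⁿ`. -/
def image (Γ : TropicalCurve n V F) : Set (Fin n → ℝ) :=
  Set.range Γ.pos ∪ ⋃ f, Γ.openEdge f

/-- The parametrization of the tropical curve is injective. -/
def IsEmbedded (Γ : TropicalCurve n V F) : Prop :=
  Function.Injective Γ.pos ∧
  (∀ v f, Γ.pos v ∉ Γ.openEdge f) ∧
  (∀ f g, g ≠ f → g ≠ Γ.opp f → Disjoint (Γ.openEdge f) (Γ.openEdge g))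

/-- Every vertex has exactly three flags. -/
def IsTrivalent (Γ : TropicalCurve n V F) : Prop :=
  ∀ v, Nat.card {f : F // Γ.vert f = v} = 3

end TropicalCurve

/-! ### Rational functions and rational one-forms on the projective line

The projective line is `OnePoint ℂ`, with affine coordinate `z` and with local coordinate
`w = 1 / z` at `∞`. The one-form `f dz` is represented by the rational function `f`. -/

lemma aeval_inv_X_injective :
    Function.Injective (Polynomial.aeval (R := ℂ) ((RatFunc.X : RatFunc ℂ)⁻¹)) := by
  rw [← transcendental_iff_injective]
  intro h
  exact RatFunc.transcendental_X (K := ℂ) (by simpa using h.inv)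

/-- The substitution `f(z) ↦ f(1/z)`. -/
def invSubst : RatFunc ℂ →ₐ[ℂ] RatFunc ℂ :=
  RatFunc.liftAlgHom (Polynomial.aeval (R := ℂ) ((RatFunc.X : RatFunc ℂ)⁻¹))
    (nonZeroDivisors_le_comap_nonZeroDivisors_of_injective _ aeval_inv_X_injective)

/-- The Laurent expansion of a rational function at a point of the projective line, in the local
coordinate `z - a` at `a` and `1 / z` at `∞`. -/
def expand : OnePoint ℂ → RatFunc ℂ →+* LaurentSeries ℂ
  | ∞ => (algebraMap (RatFunc ℂ) (LaurentSeries ℂ)).comp invSubst.toRingHom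
  | OnePoint.some a => (algebraMap (RatFunc ℂ) (LaurentSeries ℂ)).comp (RatFunc.laurent a).toRingHom

/-- The Laurent expansion of the one-form `f dz` at a point: the series `g` with
`f dz = g(s) ds` in the local coordinate `s`; at `∞`, `f(z) dz = - w⁻² f(1/w) dw`. -/
def expandForm : OnePoint ℂ → RatFunc ℂ → LaurentSeries ℂ
  | ∞, f => expand ∞ (-RatFunc.X ^ 2 * f)
  | OnePoint.some a, f => expand (OnePoint.some a) f

lemma algebraMap_C_laurent (c : ℂ) :
    algebraMap (RatFunc ℂ) (LaurentSeries ℂ) (RatFunc.C c) = HahnSeries.C c := by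
  rw [← RatFunc.algebraMap_C, ← IsScalarTower.algebraMap_apply (Polynomial ℂ) (RatFunc ℂ)
    (LaurentSeries ℂ)]
  simp

lemma expand_C (x : OnePoint ℂ) (c : ℂ) : expand x (RatFunc.C c) = HahnSeries.C c := by
  induction x using OnePoint.rec with
  | infty =>
    have h : invSubst (RatFunc.C c) = RatFunc.C c := invSubst.commutes c
    simp [expand, h, algebraMap_C_laurent]
  | coe a => simp [expand, algebraMap_C_laurent]

lemma expandForm_zero (x : OnePoint ℂ) : expandForm x 0 = 0 := by
  induction x using OnePoint.rec with
  | infty => simp [expandForm]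
  | coe a => simp [expandForm]

lemma expandForm_add (x : OnePoint ℂ) (f g : RatFunc ℂ) :
    expandForm x (f + g) = expandForm x f + expandForm x g := by
  induction x using OnePoint.rec with
  | infty => simp only [expandForm, mul_add, map_add]
  | coe a => simp only [expandForm, map_add]

lemma expandForm_smul (x : OnePoint ℂ) (c : ℂ) (f : RatFunc ℂ) :
    expandForm x (c • f) = c • expandForm x f := by
  rw [RatFunc.smul_eq_C_mul, ← HahnSeries.C_mul_eq_smul, ← expand_C x c]
  induction x using OnePoint.rec with
  | infty => simp only [expandForm, map_mul]; ring
  | coe a => simp only [expandForm, map_mul]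

/-- The residue of the one-form `f dz` at the point `x`. -/
def residue (x : OnePoint ℂ) (f : RatFunc ℂ) : ℂ := (expandForm x f).coeff (-1)

/-- The logarithmic derivative `g' / g` of a rational function `g`. -/
def dlog (g : RatFunc ℂ) : RatFunc ℂ :=
  algebraMap (Polynomial ℂ) (RatFunc ℂ) (Polynomial.derivative g.num) /
      algebraMap (Polynomial ℂ) (RatFunc ℂ) g.num -
    algebraMap (Polynomial ℂ) (RatFunc ℂ) (Polynomial.derivative g.denom) /
      algebraMap (Polynomial ℂ) (RatFunc ℂ) g.denom

/-! ### Nodal curves with rational components and their dual obstruction sections -/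

/-- A nodal curve with components `ℙ¹` indexed by the vertices of a graph, together with a map
to the toric varieties of the lattice `N = ℤⁿ` on each component. The flag `f` marks the point
`pt f` of the component `vert f`; the two flags of a bounded edge are glued to a node. On the
component `v` the toric coordinate `X_i` (the character `e_i^∨`) pulls back to `coord v i`. -/
structure ToricCurve (n : ℕ) {V F : Type*} (G : FlagGraph V F) where
  pt : F → OnePoint ℂ
  coord : V → Fin n → RatFunc ℂ

namespace ToricCurve

variable {n : ℕ} {V F : Type*}

/-- Global sections of `𝒩^∨ ⊗ ω`, where `𝒩 = (N ⊗ 𝒪) / Θ` is the logarithmic normal sheaf.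
Since `𝒩^∨` is the kernel of `N^∨ ⊗ 𝒪 → Θ^∨`, `e_i^∨ ↦ d log X_i`, such a section is an
`N^∨`-valued one-form `∑ e_i^∨ ⊗ ω_{v,i}` on every component `v` which is regular away from the
marked points, has at most logarithmic poles at the marked points, has opposite residues on the two
branches of every node, and annihilates the logarithmic tangent vectors of the curve:
`∑ ω_{v,i} ⊗ d log X_i = 0`. The points of the unbounded edges are also allowed to be poles, as
these edges are part of bounded edges of an ambient tropical curve and hence nodes of the whole
curve. -/
def dualObstructionSections {G : FlagGraph V F} (D : ToricCurve n G) :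
    Submodule ℂ (V → Fin n → RatFunc ℂ) where
  carrier := {ω |
    (∀ v i x, (∀ f, G.vert f = v → D.pt f ≠ x) → ∀ k < (0 : ℤ), (expandForm x (ω v i)).coeff k = 0) ∧
    (∀ f i, ∀ k < (-1 : ℤ), (expandForm (D.pt f) (ω (G.vert f) i)).coeff k = 0) ∧
    (∀ f, G.opp f ≠ f → ∀ i,
      residue (D.pt f) (ω (G.vert f) i) + residue (D.pt (G.opp f)) (ω (G.vert (G.opp f)) i) = 0) ∧
    (∀ v, ∑ i, ω v i * dlog (D.coord v i) = 0)}
  zero_mem' := by simp [residue, expandForm_zero]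
  add_mem' := by
    rintro a b ⟨ha1, ha2, ha3, ha4⟩ ⟨hb1, hb2, hb3, hb4⟩
    refine ⟨?_, ?_, ?_, ?_⟩
    · intro v i x hx k hk
      simp [expandForm_add, ha1 v i x hx k hk, hb1 v i x hx k hk]
    · intro f i k hk
      simp [expandForm_add, ha2 f i k hk, hb2 f i k hk]
    · intro f hf i
      have h1 := ha3 f hf i
      have h2 := hb3 f hf i
      simp only [residue, Pi.add_apply, expandForm_add, HahnSeries.coeff_add] at h1 h2 ⊢
      linear_combination h1 + h2
    · intro v
      simp [add_mul, Finset.sum_add_distrib, ha4 v, hb4 v]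
  smul_mem' := by
    rintro c a ⟨ha1, ha2, ha3, ha4⟩
    refine ⟨?_, ?_, ?_, ?_⟩
    · intro v i x hx k hk
      simp [expandForm_smul, ha1 v i x hx k hk]
    · intro f i k hk
      simp [expandForm_smul, ha2 f i k hk]
    · intro f hf i
      have h1 := ha3 f hf i
      simp only [residue, Pi.smul_apply, expandForm_smul, HahnSeries.coeff_smul, smul_eq_mul] at h1 ⊢
      linear_combination c * h1
    · intro v
      simp [← Finset.smul_sum, ha4 v]

/-- `D` is a pre-log curve of type `Γ`: on every component the marked points are distinct; the
component `v` is a torically transverse curve meeting exactly the toric divisors of the flags `f`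
at `v`, at the point `pt f` and with multiplicity the weight of `f` (so the character `e_i^∨` has
order `wt f * ⟨e_i^∨, dir f⟩` there, and neither zeros nor poles elsewhere); and the maps on the two
branches of a node agree there, i.e. the characters of the torus of the common toric divisor (those
annihilating `dir f`) take the same value on the two branches. -/
structure IsPreLogOfType [Fintype V] [Fintype F] (Γ : TropicalCurve n V F)
    (D : ToricCurve n Γ.toFlagGraph) : Prop where
  pt_injective : ∀ f g, Γ.vert f = Γ.vert g → D.pt f = D.pt g → f = g
  coord_ne_zero : ∀ v i, D.coord v i ≠ 0
  order_marked : ∀ f i, (expand (D.pt f) (D.coord (Γ.vert f) i)).order = (Γ.wt f : ℤ) * Γ.dir f i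
  order_unmarked : ∀ v i x, (∀ f, Γ.vert f = v → D.pt f ≠ x) →
    (expand x (D.coord v i)).order = 0
  node_agree : ∀ f, Γ.opp f ≠ f → ∀ m : Fin n → ℤ, ∑ i, m i * Γ.dir f i = 0 →
    (expand (D.pt f) (∏ i, D.coord (Γ.vert f) i ^ m i)).coeff 0 =
      (expand (D.pt (Γ.opp f)) (∏ i, D.coord (Γ.vert (Γ.opp f)) i ^ m i)).coeff 0

end ToricCurve

/-! ### The line in projective space -/

/-- One vertex with `r + 2` unbounded edges: `some j` for the direction `e_j`, and `none` for the
direction `- ∑ e_j`. -/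
def starGraph (r : ℕ) : FlagGraph Unit (Option (Fin (r + 1))) where
  vert := fun _ => ()
  opp := id
  opp_opp := fun _ => rfl

/-- The directions of the unbounded edges of the one-vertex tropical line in `ℝ^{r+1}`. -/
def starDir (r : ℕ) : Option (Fin (r + 1)) → Fin (r + 1) → ℤ
  | none => fun _ => -1
  | some j => Pi.single j 1

/-- The line `X_0 + X_i = p_i(t)`, `i ≥ 1`, in `ℙ^{r+1}`, with the affine coordinate `z = X_0`; it
meets the toric divisors `X_j = 0` at `z = p_j(t)` (with `p_0 = 0`) and the divisor at infinity at
`z = ∞`. -/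
def lineCurve {r : ℕ} (p : Fin (r + 1) → LaurentSeries ℂ) (t : ℂ) :
    ToricCurve (r + 1) (starGraph r) where
  pt
    | none => ∞
    | some j => OnePoint.some (value (p j) t)
  coord := fun _ i => if i = 0 then RatFunc.X else RatFunc.C (value (p i) t) - RatFunc.X

end TropLine

end

/-!
A local dual obstruction section is determined by its residues, which by the residue theorem form
a flow on the underlying tree, hence by the matrix `R` of the residues at the ends of directions
`e_j`. For the line with the marked points `a_j = p_j(t)`, the condition `∑ ωᵢ · dlog Xᵢ = 0` says
that `R j j = 0` and `∑_{i ≠ j} (R i j + R j i) / (a_j - a_i) = 0` for all `j`. The sums of these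
equations over the ends in one branch at each vertex form an equivalent system; multiplied by the
difference of two marked points in distinct branches, they tend, with an error of order `t`, to the
conditions at the vertices of the degenerate curve. The limit system is surjective, so for small `t`
the two solution spaces are identified by a map which is the identity up to terms of order `t`.
-/

noncomputable section

namespace TropLine

section VanishBelow

variable {R : Type*} [CommRing R]

/-- The Laurent series whose coefficients at exponents below `n` vanish. -/
def vanishBelow (n : ℤ) : Submodule R (LaurentSeries R) where
  carrier := {A | ∀ k < n, A.coeff k = 0}
  zero_mem' _ _ := rfl
  add_mem' hA hB k hk := by rw [HahnSeries.coeff_add, hA k hk, hB k hk, add_zero]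
  smul_mem' c A hA k hk := by rw [HahnSeries.coeff_smul, hA k hk, smul_zero]

variable {m n : ℤ} {A B : LaurentSeries R}

lemma vanishBelow_anti : Antitone (vanishBelow (R := R)) :=
  fun _ _ hmn _ hA k hk => hA k (hk.trans_le hmn)

lemma mem_vanishBelow_iff_le_orderTop : A ∈ vanishBelow n ↔ (n : WithTop ℤ) ≤ A.orderTop := by
  simp [HahnSeries.le_orderTop_iff_forall, vanishBelow]

lemma mem_vanishBelow_of_le_order (h : n ≤ A.order) : A ∈ vanishBelow n :=
  fun _ hk => HahnSeries.coeff_eq_zero_of_lt_order (hk.trans_le h)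

lemma mem_vanishBelow_add_one : A ∈ vanishBelow (n + 1) ↔ A ∈ vanishBelow n ∧ A.coeff n = 0 := by
  refine ⟨fun h => ⟨vanishBelow_anti (by lia) h, h n (by lia)⟩, fun h k hk => ?_⟩
  rcases (Int.lt_add_one_iff.mp hk).lt_or_eq with hk | rfl
  exacts [h.1 k hk, h.2]

lemma single_mem_vanishBelow (n : ℤ) (c : R) : HahnSeries.single n c ∈ vanishBelow n :=
  fun _ hk => HahnSeries.coeff_single_of_ne hk.ne

lemma mul_mem_vanishBelow (hA : A ∈ vanishBelow m) (hB : B ∈ vanishBelow n) :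
    A * B ∈ vanishBelow (m + n) := by
  rw [mem_vanishBelow_iff_le_orderTop] at *
  rw [WithTop.coe_add]
  exact (add_le_add hA hB).trans HahnSeries.orderTop_add_le_mul

lemma sub_single_mem_vanishBelow (hA : A ∈ vanishBelow n) :
    A - HahnSeries.single n (A.coeff n) ∈ vanishBelow (n + 1) :=
  mem_vanishBelow_add_one.mpr ⟨sub_mem hA (single_mem_vanishBelow _ _), by simp⟩

lemma coeff_mul_of_mem_vanishBelow (hA : A ∈ vanishBelow m) (hB : B ∈ vanishBelow n) :
    (A * B).coeff (m + n) = A.coeff m * B.coeff n := by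
  have h1 := mul_mem_vanishBelow (sub_single_mem_vanishBelow hA) hB (m + n) (by lia)
  have h2 := mul_mem_vanishBelow (single_mem_vanishBelow m (A.coeff m))
    (sub_single_mem_vanishBelow hB) (m + n) (by lia)
  rw [sub_mul, HahnSeries.coeff_sub] at h1
  rw [mul_sub, HahnSeries.coeff_sub, HahnSeries.single_mul_single, HahnSeries.coeff_single_same]
    at h2
  linear_combination h1 + h2

lemma le_order_of_mem_vanishBelow (hA : A ∈ vanishBelow n) (hA0 : A ≠ 0) : n ≤ A.order :=
  not_lt.mp fun hlt => HahnSeries.coeff_order_eq_zero.not.mpr hA0 (hA _ hlt)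

lemma order_eq_of_mem_vanishBelow (hA : A ∈ vanishBelow n) (h : A.coeff n ≠ 0) : A.order = n :=
  (HahnSeries.order_le_of_coeff_ne_zero h).antisymm
    (le_order_of_mem_vanishBelow hA fun hA0 => h (by rw [hA0, HahnSeries.coeff_zero]))

end VanishBelow

local notation "ι" => algebraMap (Polynomial ℂ) (RatFunc ℂ)

section Expansions

lemma expand_coe_X_sub_C (a b : ℂ) :
    expand (OnePoint.some b) (RatFunc.X - RatFunc.C a) =
      HahnSeries.single 1 1 + HahnSeries.C (b - a) := by
  simp [expand, algebraMap_C_laurent, RatFunc.coe_X, add_sub_assoc]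

lemma expand_infty_X : expand ∞ RatFunc.X = HahnSeries.single (-1) 1 := by
  have h : invSubst RatFunc.X = RatFunc.X⁻¹ := by
    rw [← RatFunc.algebraMap_X]
    simp [invSubst, RatFunc.liftAlgHom_apply]
  change algebraMap (RatFunc ℂ) (LaurentSeries ℂ) (invSubst RatFunc.X) = _
  rw [h, map_inv₀, RatFunc.coe_X]
  exact inv_eq_of_mul_eq_one_left (by simp)

lemma expand_infty_X_sub_C (a : ℂ) :
    expand ∞ (RatFunc.X - RatFunc.C a) = HahnSeries.single (-1) 1 - HahnSeries.C a := by
  rw [map_sub, expand_infty_X, expand_C]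

lemma X_sub_C_ne_zero (a : ℂ) : (RatFunc.X - RatFunc.C a : RatFunc ℂ) ≠ 0 := by
  simpa using (RatFunc.algebraMap_injective ℂ).ne (Polynomial.X_sub_C_ne_zero a)

lemma order_expand_mul (x : OnePoint ℂ) {f g : RatFunc ℂ} (hf : f ≠ 0) (hg : g ≠ 0) :
    (expand x (f * g)).order = (expand x f).order + (expand x g).order := by
  rw [map_mul, HahnSeries.order_mul (by simpa using hf) (by simpa using hg)]

lemma order_expand_inv (x : OnePoint ℂ) {f : RatFunc ℂ} (hf : f ≠ 0) :
    (expand x f⁻¹).order = -(expand x f).order := by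
  have h := order_expand_mul x hf (inv_ne_zero hf)
  rw [mul_inv_cancel₀ hf, map_one, HahnSeries.order_one] at h
  lia

lemma order_expand_C (x : OnePoint ℂ) (c : ℂ) : (expand x (RatFunc.C c)).order = 0 := by
  rw [expand_C, HahnSeries.order_C]

open Classical in
lemma order_expand_X_sub_C (x : OnePoint ℂ) (a : ℂ) :
    (expand x (RatFunc.X - RatFunc.C a)).order =
      (if x = OnePoint.some a then 1 else 0) - (if x = ∞ then 1 else 0) := by
  have hC (c : ℂ) : (HahnSeries.C c : LaurentSeries ℂ) ∈ vanishBelow 0 :=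
    single_mem_vanishBelow 0 c
  have hs (n : ℤ) : (HahnSeries.single n 1 : LaurentSeries ℂ) ∈ vanishBelow n :=
    single_mem_vanishBelow n 1
  induction x using OnePoint.rec with
  | infty =>
    rw [expand_infty_X_sub_C, order_eq_of_mem_vanishBelow (n := -1)
      (sub_mem (hs _) (vanishBelow_anti (by norm_num) (hC a))) (by simp)]
    simp
  | coe b =>
    rw [expand_coe_X_sub_C]
    by_cases hba : b = a
    · simp [hba]
    · rw [order_eq_of_mem_vanishBelow (n := 0)
        (add_mem (vanishBelow_anti (by norm_num) (hs 1)) (hC _)) (by simp [sub_eq_zero, hba])]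
      simp [hba]

end Expansions

section Residues

/-- `expandForm x` as a linear map. -/
def expandFormHom (x : OnePoint ℂ) : RatFunc ℂ →ₗ[ℂ] LaurentSeries ℂ where
  toFun := expandForm x
  map_add' := expandForm_add x
  map_smul' := expandForm_smul x

/-- `residue x` as a linear map. -/
def residueHom (x : OnePoint ℂ) : RatFunc ℂ →ₗ[ℂ] ℂ where
  toFun := residue x
  map_add' f g := by simp [residue, expandForm_add]
  map_smul' c f := by simp [residue, expandForm_smul]

lemma expandFormHom_apply (x : OnePoint ℂ) (f : RatFunc ℂ) :
    expandFormHom x f = expandForm x f := rfl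

lemma residueHom_apply (x : OnePoint ℂ) (f : RatFunc ℂ) : residueHom x f = residue x f := rfl

lemma residue_sum_smul {κ : Type*} (x : OnePoint ℂ) (s : Finset κ) (c : κ → ℂ)
    (f : κ → RatFunc ℂ) : residue x (∑ i ∈ s, c i • f i) = ∑ i ∈ s, c i * residue x (f i) :=
  (map_sum (residueHom x) _ _).trans (Finset.sum_congr rfl fun _ _ => map_smul (residueHom x) _ _)

lemma expandForm_infty (f : RatFunc ℂ) : expandForm ∞ f = expand ∞ (-RatFunc.X ^ 2 * f) := rfl

lemma expandForm_coe (a : ℂ) (f : RatFunc ℂ) :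
    expandForm (OnePoint.some a) f = expand (OnePoint.some a) f := rfl

lemma order_expandForm_infty {f : RatFunc ℂ} (hf : f ≠ 0) :
    (expandForm ∞ f).order = (expand ∞ f).order - 2 := by
  have h : (expand ∞ (-RatFunc.X ^ 2)).order = -2 := by
    rw [map_neg, map_pow, expand_infty_X, HahnSeries.order_neg]
    simp
  rw [expandForm_infty, order_expand_mul _ (by simp [RatFunc.X_ne_zero]) hf, h]
  ring

/-- The form `dz / (z - a)` for a finite point `a`, and `0` for `∞`. A form with simple poles is the
combination of the `eta y` whose coefficients are its residues at the poles `y`. -/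
def eta : OnePoint ℂ → RatFunc ℂ
  | ∞ => 0
  | OnePoint.some a => (RatFunc.X - RatFunc.C a)⁻¹

lemma eta_coe (a : ℂ) : eta (OnePoint.some a) = (RatFunc.X - RatFunc.C a)⁻¹ := rfl

lemma expandForm_eta_mem (x y : OnePoint ℂ) : expandForm x (eta y) ∈ vanishBelow (-1) := by
  classical
  induction y using OnePoint.rec with
  | infty => simp [eta, expandForm_zero]
  | coe a =>
    refine mem_vanishBelow_of_le_order ?_
    have hinv : eta (OnePoint.some a) ≠ 0 := inv_ne_zero (X_sub_C_ne_zero a)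
    have horder := order_expand_inv x (X_sub_C_ne_zero a)
    rw [order_expand_X_sub_C] at horder
    induction x using OnePoint.rec with
    | infty =>
      rw [order_expandForm_infty hinv, eta_coe, horder]
      simp
    | coe b =>
      rw [expandForm_coe, eta_coe, horder]
      split_ifs <;> simp_all

open Classical in
lemma residue_eta (x y : OnePoint ℂ) :
    residue x (eta y) = (if x = y then 1 else 0) - (if x = ∞ then 1 else 0) := by
  induction y using OnePoint.rec with
  | infty => simp [eta, residue, expandForm_zero]
  | coe a =>
    induction x using OnePoint.rec with
    | infty =>
      have hX : expand ∞ (RatFunc.X - RatFunc.C a) ∈ vanishBelow (-1) :=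
        mem_vanishBelow_of_le_order (by rw [order_expand_X_sub_C]; simp)
      have h := coeff_mul_of_mem_vanishBelow (expandForm_eta_mem ∞ (OnePoint.some a)) hX
      rw [expandForm_infty, ← map_mul, eta_coe, mul_assoc, inv_mul_cancel₀ (X_sub_C_ne_zero a),
        mul_one, map_neg, map_pow, expand_infty_X, expand_infty_X_sub_C] at h
      simpa [residue, expandForm, eta] using h.symm
    | coe b =>
      have hX : expand (OnePoint.some b) (RatFunc.X - RatFunc.C a) ∈ vanishBelow 0 :=
        mem_vanishBelow_of_le_order (by rw [order_expand_X_sub_C]; split_ifs <;> simp_all)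
      by_cases hba : b = a
      · simp [residue, expandForm, eta, hba, expand_coe_X_sub_C]
      · have h := coeff_mul_of_mem_vanishBelow (expandForm_eta_mem b (OnePoint.some a)) hX
        rw [expandForm_coe, ← map_mul, eta_coe, inv_mul_cancel₀ (X_sub_C_ne_zero a),
          expand_coe_X_sub_C] at h
        simpa [residue, expandForm, eta, hba, sub_eq_zero] using h

end Residues

section LogarithmicDerivatives

lemma derivative_div_eq_sum_eta {P : Polynomial ℂ} (hP : P ≠ 0) :
    ι (Polynomial.derivative P) / ι P = (P.roots.map fun a => eta (OnePoint.some a)).sum := by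
  have hsplit := IsAlgClosed.splits P
  have heval (Q : Polynomial ℂ) : (Q.map RatFunc.C).eval RatFunc.X = ι Q := by
    rw [Polynomial.eval_map, ← RatFunc.algebraMap_eq_C, ← Polynomial.aeval_def,
      RatFunc.aeval_X_left_eq_algebraMap]
  have h := (hsplit.map RatFunc.C).eval_derivative_div_eval_of_ne_zero (x := RatFunc.X)
    (by simpa [heval] using hP)
  rw [Polynomial.derivative_map, heval, heval, hsplit.roots_map, Multiset.map_map] at h
  exact h.trans (congrArg Multiset.sum (Multiset.map_congr rfl fun a _ => one_div _))

lemma order_expand_polynomial {P : Polynomial ℂ} (hP : P ≠ 0) (x : OnePoint ℂ) :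
    ((expand x (ι P)).order : ℂ) = residue x (ι (Polynomial.derivative P) / ι P) := by
  classical
  have hprod : ι P = RatFunc.C P.leadingCoeff *
      (P.roots.map fun a => RatFunc.X - RatFunc.C a).prod := by
    conv_lhs => rw [(IsAlgClosed.splits P).eq_prod_roots]
    simp [map_multiset_prod, Function.comp_def]
  have hne (s : Multiset ℂ) : (s.map fun a => RatFunc.X - RatFunc.C a).prod ≠ 0 :=
    Multiset.prod_ne_zero (by simpa using fun a _ => X_sub_C_ne_zero a)
  rw [derivative_div_eq_sum_eta hP, hprod, order_expand_mul x (by simpa using hP) (hne _),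
    order_expand_C, zero_add, ← residueHom_apply, map_multiset_sum, Multiset.map_map]
  induction P.roots using Multiset.induction_on with
  | empty => simp
  | cons a s ih =>
    rw [Multiset.map_cons, Multiset.prod_cons, order_expand_mul x (X_sub_C_ne_zero a) (hne s),
      Int.cast_add, ih, Multiset.map_cons, Multiset.sum_cons, order_expand_X_sub_C,
      Function.comp_apply, residueHom_apply, residue_eta]
    push_cast
    rfl

lemma dlog_eq_sum_eta {g : RatFunc ℂ} (hg : g ≠ 0) :
    dlog g = (g.num.roots.map fun a => eta (OnePoint.some a)).sum -
      (g.denom.roots.map fun a => eta (OnePoint.some a)).sum := by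
  rw [dlog, derivative_div_eq_sum_eta (RatFunc.num_ne_zero hg),
    derivative_div_eq_sum_eta g.denom_ne_zero]

lemma expandForm_dlog_mem {g : RatFunc ℂ} (hg : g ≠ 0) (x : OnePoint ℂ) :
    expandForm x (dlog g) ∈ vanishBelow (-1) := by
  have h (s : Multiset ℂ) :
      expandFormHom x (s.map fun a => eta (OnePoint.some a)).sum ∈ vanishBelow (-1) := by
    rw [map_multiset_sum]
    refine multiset_sum_mem _ fun A hA => ?_
    simp only [Multiset.map_map, Multiset.mem_map] at hA
    obtain ⟨a, -, rfl⟩ := hA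
    exact expandForm_eta_mem x (OnePoint.some a)
  rw [← expandFormHom_apply, dlog_eq_sum_eta hg, map_sub]
  exact sub_mem (h _) (h _)

lemma residue_dlog {g : RatFunc ℂ} (hg : g ≠ 0) (x : OnePoint ℂ) :
    residue x (dlog g) = (expand x g).order := by
  have hnum : ι g.num ≠ 0 := by simpa using hg
  have hdenom : ι g.denom ≠ 0 := by simpa using g.denom_ne_zero
  rw [dlog, ← residueHom_apply, map_sub, residueHom_apply, residueHom_apply,
    ← order_expand_polynomial (RatFunc.num_ne_zero hg), ← order_expand_polynomial g.denom_ne_zero]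
  conv_rhs => rw [← g.num_div_denom, div_eq_mul_inv,
    order_expand_mul x hnum (inv_ne_zero hdenom), order_expand_inv x hdenom]
  push_cast
  ring

lemma exists_sum_order_expand_eq_zero {g : RatFunc ℂ} (hg : g ≠ 0) :
    ∃ S : Finset (OnePoint ℂ), ∞ ∈ S ∧ ∑ x ∈ S, (expand x g).order = 0 := by
  classical
  set S : Finset (OnePoint ℂ) :=
    insert ∞ ((g.num.roots + g.denom.roots).toFinset.image OnePoint.some)
  have hinf : ∞ ∈ S := Finset.mem_insert_self _ _
  have hS (s : Multiset ℂ) (hs : ∀ a ∈ s, OnePoint.some a ∈ S) :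
      (∑ x ∈ S, residueHom x) (s.map fun a => eta (OnePoint.some a)).sum = 0 := by
    rw [map_multiset_sum, Multiset.map_map]
    refine Multiset.sum_eq_zero fun c hc => ?_
    obtain ⟨a, ha, rfl⟩ := Multiset.mem_map.mp hc
    simp [residueHom_apply, residue_eta, hs a ha, hinf]
  refine ⟨S, hinf, ?_⟩
  have hsum : (∑ x ∈ S, residueHom x) (dlog g) = 0 := by
    rw [dlog_eq_sum_eta hg, map_sub, hS _ fun a ha => ?_, hS _ fun a ha => ?_, sub_zero]
    all_goals exact Finset.mem_insert_of_mem (Finset.mem_image_of_mem _ (by simp_all))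
  simp_rw [LinearMap.sum_apply, residueHom_apply, residue_dlog hg] at hsum
  exact_mod_cast hsum

lemma eq_zero_of_residue_eq_zero {f : RatFunc ℂ}
    (hf : ∀ x, expandForm x f ∈ vanishBelow (-1)) (hres : ∀ a : ℂ, residue a f = 0) : f = 0 := by
  by_contra hne
  obtain ⟨S, hinf, hS⟩ := exists_sum_order_expand_eq_zero hne
  have hpos : 0 < (expand ∞ f).order := by
    have hne' : expandForm ∞ f ≠ 0 := by simpa [expandForm_infty, RatFunc.X_ne_zero] using hne
    have h := le_order_of_mem_vanishBelow (hf ∞) hne'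
    rw [order_expandForm_infty hne] at h
    lia
  refine (Finset.sum_pos' (fun x _ => ?_) ⟨∞, hinf, hpos⟩).ne' hS
  induction x using OnePoint.rec with
  | infty => exact hpos.le
  | coe a =>
    have h : expandForm a f ∈ vanishBelow (-1 + 1) := mem_vanishBelow_add_one.mpr ⟨hf a, hres a⟩
    exact le_order_of_mem_vanishBelow h (by simpa [expandForm_coe] using hne)

end LogarithmicDerivatives

section LogForms

/-- The one-forms with at most logarithmic poles in `S` and no other poles. -/
def logForms (S : Set (OnePoint ℂ)) : Submodule ℂ (RatFunc ℂ) :=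
  (⨅ x, (vanishBelow (-1)).comap (expandFormHom x)) ⊓ ⨅ x ∈ Sᶜ, LinearMap.ker (residueHom x)

lemma mem_logForms {S : Set (OnePoint ℂ)} {f : RatFunc ℂ} :
    f ∈ logForms S ↔ (∀ x, expandForm x f ∈ vanishBelow (-1)) ∧ ∀ x ∉ S, residue x f = 0 := by
  simp [logForms, expandFormHom_apply, residueHom_apply]

lemma dlog_mem_logForms {S : Set (OnePoint ℂ)} {g : RatFunc ℂ} (hg : g ≠ 0)
    (h : ∀ x ∉ S, (expand x g).order = 0) : dlog g ∈ logForms S :=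
  mem_logForms.mpr
    ⟨expandForm_dlog_mem hg, fun x hx => by rw [residue_dlog hg, h x hx, Int.cast_zero]⟩

variable {κ : Type*} [Fintype κ] {pt : κ → OnePoint ℂ}

lemma expandForm_sum_smul_eta_mem (ρ : κ → ℂ) (x : OnePoint ℂ) :
    expandForm x (∑ k, ρ k • eta (pt k)) ∈ vanishBelow (-1) := by
  rw [← expandFormHom_apply, map_sum]
  refine sum_mem fun k _ => ?_
  rw [map_smul]
  exact Submodule.smul_mem _ _ (expandForm_eta_mem x (pt k))

open Classical in
lemma residue_sum_smul_eta (ρ : κ → ℂ) (x : OnePoint ℂ) :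
    residue x (∑ k, ρ k • eta (pt k)) =
      (∑ k with x = pt k, ρ k) - if x = ∞ then ∑ k, ρ k else 0 := by
  simp only [residue_sum_smul, residue_eta, mul_sub, Finset.sum_sub_distrib, mul_ite, mul_one,
    mul_zero, Finset.sum_filter]
  split_ifs <;> simp

lemma sum_smul_eta_mem_logForms {ρ : κ → ℂ} (hρ : ∑ k, ρ k = 0) :
    ∑ k, ρ k • eta (pt k) ∈ logForms (Set.range pt) := by
  classical
  refine mem_logForms.mpr ⟨expandForm_sum_smul_eta_mem ρ, fun x hx => ?_⟩
  rw [residue_sum_smul_eta, hρ, ite_self, sub_zero]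
  exact Finset.sum_eq_zero fun k hk => absurd ⟨k, (Finset.mem_filter.mp hk).2.symm⟩ hx

lemma residue_pt_sum_smul_eta (hpt : pt.Injective) {ρ : κ → ℂ} (hρ : ∑ k, ρ k = 0) (k : κ) :
    residue (pt k) (∑ l, ρ l • eta (pt l)) = ρ k := by
  classical
  simp [residue_sum_smul_eta, hρ, hpt.eq_iff, Finset.sum_filter]

open Classical in
lemma sum_residue_filter_eq (hpt : pt.Injective) {f : RatFunc ℂ} (hf : f ∈ logForms (Set.range pt))
    (x : OnePoint ℂ) : ∑ k with x = pt k, residue (pt k) f = residue x f := by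
  by_cases hx : x ∈ Set.range pt
  · obtain ⟨l, rfl⟩ := hx
    simp [hpt.eq_iff, Finset.sum_filter]
  · rw [(mem_logForms.mp hf).2 x hx]
    exact Finset.sum_eq_zero fun k hk => absurd ⟨k, (Finset.mem_filter.mp hk).2.symm⟩ hx

lemma eq_sum_residue_smul_eta (hpt : pt.Injective) {f : RatFunc ℂ}
    (hf : f ∈ logForms (Set.range pt)) : f = ∑ k, residue (pt k) f • eta (pt k) := by
  classical
  refine sub_eq_zero.mp (eq_zero_of_residue_eq_zero (fun x => ?_) fun a => ?_)
  · rw [← expandFormHom_apply, map_sub]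
    exact sub_mem ((mem_logForms.mp hf).1 x) (expandForm_sum_smul_eta_mem _ x)
  · rw [← residueHom_apply, map_sub, residueHom_apply, residueHom_apply, residue_sum_smul_eta,
      sum_residue_filter_eq hpt hf]
    simp

lemma sum_residue_eq_zero (hpt : pt.Injective) {f : RatFunc ℂ}
    (hf : f ∈ logForms (Set.range pt)) : ∑ k, residue (pt k) f = 0 := by
  classical
  have h := congrArg (residue ∞) (eq_sum_residue_smul_eta hpt hf)
  rw [residue_sum_smul_eta, sum_residue_filter_eq hpt hf, if_pos rfl] at h
  linear_combination h

end LogForms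

section ResiduePairing

variable {J : Type*} [Fintype J]

/-- The quadratic differential `∑ fⱼ gⱼ dz²` of two families with logarithmic poles has a pole of
order at most two, with leading coefficient the pairing of the residues. -/
lemma sum_residue_mul_residue_eq_zero {f g : J → RatFunc ℂ} {x : OnePoint ℂ}
    (hf : ∀ j, expandForm x (f j) ∈ vanishBelow (-1))
    (hg : ∀ j, expandForm x (g j) ∈ vanishBelow (-1)) (h : ∑ j, f j * g j = 0) :
    ∑ j, residue x (f j) * residue x (g j) = 0 := by
  have hprod : ∑ j, expandForm x (f j) * expandForm x (g j) = 0 := by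
    induction x using OnePoint.rec with
    | infty =>
      simp only [expandForm, ← map_mul, ← map_sum]
      rw [Finset.sum_congr rfl fun j _ => mul_mul_mul_comm _ (f j) _ (g j), ← Finset.mul_sum, h,
        mul_zero, map_zero]
    | coe a => simp only [expandForm, ← map_mul, ← map_sum, h, map_zero]
  have hcoeff := congrArg (HahnSeries.coeff · (-1 + -1)) hprod
  simpa only [HahnSeries.coeff_sum, coeff_mul_of_mem_vanishBelow (hf _) (hg _),
    HahnSeries.coeff_zero, residue] using hcoeff

lemma add_swap_eq_zero_of_fin_three {M : Type*} [AddCommGroup M] {B : Fin 3 → Fin 3 → M}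
    (hdiag : ∀ k, B k k = 0) (hrow : ∀ k, ∑ l, B k l = 0) (hcol : ∀ l, ∑ k, B k l = 0)
    (k l : Fin 3) : B k l + B l k = 0 := by
  simp only [Fin.sum_univ_three] at hrow hcol
  fin_cases k <;> fin_cases l <;> grind

/-- The pairings `B k l` of the residues at the `k`-th and the `l`-th point vanish on the diagonal
and have row and column sums zero, so for three points `B` is antisymmetric. -/
lemma sum_mul_eq_zero_of_three_points {pt : Fin 3 → OnePoint ℂ} (hpt : pt.Injective)
    {f g : J → RatFunc ℂ} (hf : ∀ j, f j ∈ logForms (Set.range pt))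
    (hg : ∀ j, g j ∈ logForms (Set.range pt))
    (h : ∀ k, ∑ j, residue (pt k) (f j) * residue (pt k) (g j) = 0) :
    ∑ j, f j * g j = 0 := by
  set B : Fin 3 → Fin 3 → ℂ := fun k l => ∑ j, residue (pt k) (f j) * residue (pt l) (g j)
  have hrow (k) : ∑ l, B k l = 0 := by
    rw [Finset.sum_comm]
    simp_rw [← Finset.mul_sum, sum_residue_eq_zero hpt (hg _), mul_zero, Finset.sum_const_zero]
  have hcol (l) : ∑ k, B k l = 0 := by
    rw [Finset.sum_comm]
    simp_rw [← Finset.sum_mul, sum_residue_eq_zero hpt (hf _), zero_mul, Finset.sum_const_zero]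
  have hanti := add_swap_eq_zero_of_fin_three h hrow hcol
  have hexp : ∑ j, f j * g j = ∑ k, ∑ l, B k l • (eta (pt k) * eta (pt l)) := by
    have hprod (j) : f j * g j = ∑ k, ∑ l, (residue (pt k) (f j) * residue (pt l) (g j)) •
        (eta (pt k) * eta (pt l)) := by
      conv_lhs => rw [eq_sum_residue_smul_eta hpt (hf j), eq_sum_residue_smul_eta hpt (hg j)]
      simp_rw [Finset.sum_mul_sum, smul_mul_smul_comm]
    simp_rw [hprod, B, Finset.sum_smul]
    rw [Finset.sum_comm]
    exact Finset.sum_congr rfl fun k _ => Finset.sum_comm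
  have hswap : ∑ k, ∑ l, B k l • (eta (pt k) * eta (pt l)) =
      -∑ k, ∑ l, B k l • (eta (pt k) * eta (pt l)) := by
    conv_lhs => rw [Finset.sum_comm]
    simp_rw [← Finset.sum_neg_distrib, ← neg_smul, ← eq_neg_of_add_eq_zero_left (hanti _ _),
      mul_comm]
  rw [hexp]
  exact self_eq_neg.mp hswap

end ResiduePairing

section Sections

variable {n : ℕ} {V F : Type*} {G : FlagGraph V F} {D : ToricCurve n G}

/-- The marked points on the component `v`. -/
def ToricCurve.componentPt (D : ToricCurve n G) (v : V) (f : {f // G.vert f = v}) : OnePoint ℂ :=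
  D.pt f

lemma ToricCurve.forall_mem_logForms_iff {ω : V → Fin n → RatFunc ℂ} :
    (∀ v i, ω v i ∈ logForms (Set.range (D.componentPt v))) ↔
      (∀ v i x, (∀ f, G.vert f = v → D.pt f ≠ x) →
        ∀ k < (0 : ℤ), (expandForm x (ω v i)).coeff k = 0) ∧
      ∀ f i, ∀ k < (-1 : ℤ), (expandForm (D.pt f) (ω (G.vert f) i)).coeff k = 0 := by
  have hrange {v x} : x ∉ Set.range (D.componentPt v) ↔ ∀ f, G.vert f = v → D.pt f ≠ x := by
    simp [componentPt]
  constructor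
  · refine fun h => ⟨fun v i x hx => ?_, fun f i => (mem_logForms.mp (h _ i)).1 _⟩
    obtain ⟨hpole, hres⟩ := mem_logForms.mp (h v i)
    exact mem_vanishBelow_add_one.mpr ⟨hpole x, hres x (hrange.mpr hx)⟩
  · rintro ⟨hunmarked, hmarked⟩ v i
    refine mem_logForms.mpr ⟨fun x => ?_,
      fun x hx => hunmarked v i x (hrange.mp hx) _ neg_one_lt_zero⟩
    by_cases hx : x ∈ Set.range (D.componentPt v)
    · obtain ⟨⟨f, rfl⟩, rfl⟩ := hx
      exact hmarked f i
    · exact vanishBelow_anti neg_one_lt_zero.le (hunmarked v i x (hrange.mp hx))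

lemma ToricCurve.mem_dualObstructionSections_iff {ω : V → Fin n → RatFunc ℂ} :
    ω ∈ D.dualObstructionSections ↔
      (∀ v i, ω v i ∈ logForms (Set.range (D.componentPt v))) ∧
      (∀ f, G.opp f ≠ f → ∀ i, residue (D.pt (G.opp f)) (ω (G.vert (G.opp f)) i) =
        -residue (D.pt f) (ω (G.vert f) i)) ∧
      ∀ v, ∑ i, ω v i * dlog (D.coord v i) = 0 := by
  simp_rw [forall_mem_logForms_iff, eq_neg_iff_add_eq_zero, add_comm (residue (D.pt (G.opp _)) _)]
  exact and_assoc.symm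

variable [Fintype F]

open Classical in
/-- A flow on a graph: opposite values on the two flags of a bounded edge, and conservation at every
vertex. These are the constraints on the residues of a one-form with logarithmic poles at the nodes
and marked points of a nodal curve with rational components. -/
structure FlagGraph.IsFlow (G : FlagGraph V F) (ρ : F → ℂ) : Prop where
  opp : ∀ f, G.opp f ≠ f → ρ (G.opp f) = -ρ f
  conserved : ∀ v, ∑ f with G.vert f = v, ρ f = 0

/-- The columns of `dir` are flows, and every flow is the combination of these columns with
coefficients its values at the flags `leaf j`. -/
structure FlagGraph.IsFlowFrame (G : FlagGraph V F) (dir : F → Fin n → ℤ) (leaf : Fin n → F) :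
    Prop where
  isFlow : ∀ j, G.IsFlow fun f => dir f j
  dir_leaf : ∀ j, dir (leaf j) = Pi.single j 1
  eq_sum : ∀ ρ, G.IsFlow ρ → ∀ f, ρ f = ∑ j, dir f j * ρ (leaf j)

/-- The residue at the flag `f` of the forms with residues `R j` at the flags `leaf j`. -/
def flowResidue (dir : F → Fin n → ℤ) (R : Fin n → Fin n → ℂ) (f : F) (i : Fin n) : ℂ :=
  ∑ j, dir f j * R j i

lemma FlagGraph.IsFlow.sum_subtype {ρ : F → ℂ} (hρ : G.IsFlow ρ) (v : V)
    [Fintype {f // G.vert f = v}] : ∑ f : {f // G.vert f = v}, ρ f = 0 := by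
  classical
  rw [← hρ.conserved v, Finset.sum_subtype (p := fun f => G.vert f = v) _ (by simp)]

lemma FlagGraph.IsFlow.sum_mul {J : Type*} [Fintype J] {ρ : J → F → ℂ}
    (hρ : ∀ j, G.IsFlow (ρ j)) (c : J → ℂ) : G.IsFlow fun f => ∑ j, ρ j f * c j := by
  refine ⟨fun f hf => ?_, fun v => ?_⟩
  · simp_rw [(hρ _).opp f hf, neg_mul, Finset.sum_neg_distrib]
  · rw [Finset.sum_comm]
    simp_rw [← Finset.sum_mul, (hρ _).conserved, zero_mul, Finset.sum_const_zero]

lemma FlagGraph.IsFlowFrame.isFlow_flowResidue {dir : F → Fin n → ℤ} {leaf : Fin n → F}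
    (h : G.IsFlowFrame dir leaf) (R : Fin n → Fin n → ℂ) (i : Fin n) :
    G.IsFlow fun f => flowResidue dir R f i :=
  FlagGraph.IsFlow.sum_mul h.isFlow fun j => R j i

lemma FlagGraph.IsFlowFrame.flowResidue_leaf {dir : F → Fin n → ℤ} {leaf : Fin n → F}
    (h : G.IsFlowFrame dir leaf) (R : Fin n → Fin n → ℂ) (j i : Fin n) :
    flowResidue dir R (leaf j) i = R j i := by
  simp [flowResidue, h.dir_leaf, Pi.single_apply]

open Classical in
/-- The one-forms on the components with residue `ρ f i` at the marked point of the flag `f`. -/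
def ToricCurve.formsOfResidues (D : ToricCurve n G) (ρ : F → Fin n → ℂ) : V → Fin n → RatFunc ℂ :=
  fun v i => ∑ f : {f // G.vert f = v}, ρ f i • eta (D.componentPt v f)

variable (hpt : ∀ v, (D.componentPt v).Injective)
include hpt

lemma ToricCurve.residue_formsOfResidues {ρ : F → Fin n → ℂ} (hρ : ∀ i, G.IsFlow fun f => ρ f i)
    (f : F) (i : Fin n) : residue (D.pt f) (D.formsOfResidues ρ (G.vert f) i) = ρ f i := by
  classical
  exact residue_pt_sum_smul_eta (hpt _) ((hρ i).sum_subtype _) ⟨f, rfl⟩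

lemma ToricCurve.formsOfResidues_residue {ω : V → Fin n → RatFunc ℂ}
    (hω : ω ∈ D.dualObstructionSections) :
    D.formsOfResidues (fun f i => residue (D.pt f) (ω (G.vert f) i)) = ω := by
  classical
  funext v i
  rw [eq_sum_residue_smul_eta (hpt v) ((mem_dualObstructionSections_iff.mp hω).1 v i),
    formsOfResidues]
  refine Finset.sum_congr rfl ?_
  rintro ⟨f, rfl⟩ -
  rfl

lemma ToricCurve.isFlow_residue {ω : V → Fin n → RatFunc ℂ} (hω : ω ∈ D.dualObstructionSections)
    (i : Fin n) : G.IsFlow fun f => residue (D.pt f) (ω (G.vert f) i) := by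
  classical
  obtain ⟨hlog, hnode, -⟩ := mem_dualObstructionSections_iff.mp hω
  refine ⟨fun f hf => hnode f hf i, fun v => ?_⟩
  rw [← sum_residue_eq_zero (hpt v) (hlog v i),
    Finset.sum_subtype (p := fun f => G.vert f = v) _ (by simp)]
  refine Finset.sum_congr rfl ?_
  rintro ⟨f, rfl⟩ -
  rfl

lemma ToricCurve.formsOfResidues_mem_iff {ρ : F → Fin n → ℂ} (hρ : ∀ i, G.IsFlow fun f => ρ f i) :
    D.formsOfResidues ρ ∈ D.dualObstructionSections ↔
      ∀ v, ∑ i, D.formsOfResidues ρ v i * dlog (D.coord v i) = 0 := by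
  classical
  refine mem_dualObstructionSections_iff.trans ⟨fun h => h.2.2, fun h =>
    ⟨fun v i => sum_smul_eta_mem_logForms ((hρ i).sum_subtype v), fun f hf i => ?_, h⟩⟩
  rw [residue_formsOfResidues hpt hρ, residue_formsOfResidues hpt hρ, (hρ i).opp f hf]

lemma ToricCurve.exists_residue_equiv {dir : F → Fin n → ℤ} {leaf : Fin n → F}
    (hframe : G.IsFlowFrame dir leaf) (W : Submodule ℂ (Fin n → Fin n → ℂ))
    (hW : ∀ R, R ∈ W ↔
      ∀ v, ∑ i, D.formsOfResidues (flowResidue dir R) v i * dlog (D.coord v i) = 0) :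
    ∃ Ψ : D.dualObstructionSections ≃ₗ[ℂ] W, ∀ (ω : D.dualObstructionSections) f i,
      residue (D.pt f) (ω.1 (G.vert f) i) = flowResidue dir (Ψ ω).1 f i := by
  let res : (V → Fin n → RatFunc ℂ) →ₗ[ℂ] Fin n → Fin n → ℂ :=
    LinearMap.pi fun j => LinearMap.pi fun i =>
      residueHom (D.pt (leaf j)) ∘ₗ LinearMap.proj i ∘ₗ LinearMap.proj (G.vert (leaf j))
  have hres (ω) (hω : ω ∈ D.dualObstructionSections) (f i) :
      residue (D.pt f) (ω (G.vert f) i) = flowResidue dir (res ω) f i :=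
    hframe.eq_sum _ (isFlow_residue hpt hω i) f
  have hmem (R) : R ∈ W ↔ D.formsOfResidues (flowResidue dir R) ∈ D.dualObstructionSections := by
    rw [hW, formsOfResidues_mem_iff hpt (hframe.isFlow_flowResidue R)]
  have hform (ω) (hω : ω ∈ D.dualObstructionSections) :
      D.formsOfResidues (flowResidue dir (res ω)) = ω :=
    (congrArg _ (funext₂ (hres ω hω)).symm).trans (formsOfResidues_residue hpt hω)
  have hmaps (ω) (hω : ω ∈ D.dualObstructionSections) : res ω ∈ W :=
    (hmem _).mpr ((hform ω hω).symm ▸ hω)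
  refine ⟨LinearEquiv.ofBijective (res.restrict hmaps) ⟨fun ω ω' h => Subtype.ext ?_, fun R => ?_⟩,
    fun ω => hres ω ω.2⟩
  · rw [← hform ω ω.2, ← hform ω' ω'.2, show res ω = res ω' from congrArg Subtype.val h]
  · refine ⟨⟨_, (hmem R).mp R.2⟩, Subtype.ext (funext₂ fun j i => ?_)⟩
    exact (residue_formsOfResidues hpt (hframe.isFlow_flowResidue R.1) (leaf j) i).trans
      (hframe.flowResidue_leaf R.1 j i)

end Sections

section PreLog

variable {n : ℕ} {V F : Type*} [Fintype V] [Fintype F] {Γ : TropicalCurve n V F}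
  {D : ToricCurve n Γ.toFlagGraph}

namespace ToricCurve.IsPreLogOfType

variable (hD : D.IsPreLogOfType Γ)
include hD

lemma componentPt_injective (v : V) : (D.componentPt v).Injective := fun f g h =>
  Subtype.ext (hD.pt_injective f g (f.2.trans g.2.symm) h)

lemma dlog_coord_mem_logForms (v : V) (i : Fin n) :
    dlog (D.coord v i) ∈ logForms (Set.range (D.componentPt v)) :=
  dlog_mem_logForms (hD.coord_ne_zero v i) fun x hx =>
    hD.order_unmarked v i x fun f hf h => hx ⟨⟨f, hf⟩, h⟩

lemma residue_dlog_coord (f : F) (i : Fin n) :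
    residue (D.pt f) (dlog (D.coord (Γ.vert f) i)) = Γ.wt f * Γ.dir f i := by
  rw [residue_dlog (hD.coord_ne_zero _ i), hD.order_marked]
  push_cast
  rfl

lemma sum_formsOfResidues_mul_dlog_eq_zero_iff (htri : Γ.IsTrivalent) {ρ : F → Fin n → ℂ}
    (hρ : ∀ i, Γ.IsFlow fun f => ρ f i) :
    (∀ v, ∑ i, D.formsOfResidues ρ v i * dlog (D.coord v i) = 0) ↔
      ∀ f, ∑ i, ρ f i * Γ.dir f i = 0 := by
  classical
  have hforms (v) (i) : D.formsOfResidues ρ v i ∈ logForms (Set.range (D.componentPt v)) :=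
    sum_smul_eta_mem_logForms ((hρ i).sum_subtype v)
  have hpairing (f) : ∑ i, residue (D.pt f) (D.formsOfResidues ρ (Γ.vert f) i) *
      residue (D.pt f) (dlog (D.coord (Γ.vert f) i)) = 0 ↔ ∑ i, ρ f i * Γ.dir f i = 0 := by
    simp_rw [residue_formsOfResidues hD.componentPt_injective hρ, hD.residue_dlog_coord,
      mul_left_comm _ (Γ.wt f : ℂ), ← Finset.mul_sum, mul_eq_zero, Nat.cast_eq_zero,
      (Γ.wt_pos f).ne', false_or]
  constructor
  · exact fun h f => (hpairing f).mp <| sum_residue_mul_residue_eq_zero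
      (fun i => (mem_logForms.mp (hforms _ i)).1 _)
      (fun i => (mem_logForms.mp (hD.dlog_coord_mem_logForms _ i)).1 _) (h (Γ.vert f))
  · intro h v
    let e : Fin 3 ≃ {f // Γ.vert f = v} := (Finite.equivFinOfCardEq (htri v)).symm
    have hrange : Set.range (D.componentPt v ∘ e) = Set.range (D.componentPt v) :=
      EquivLike.range_comp _ e
    refine sum_mul_eq_zero_of_three_points ((hD.componentPt_injective v).comp e.injective)
      (fun i => hrange ▸ hforms v i) (fun i => hrange ▸ hD.dlog_coord_mem_logForms v i) fun k => ?_
    obtain ⟨f, hf⟩ : ∃ f, e k = f := ⟨_, rfl⟩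
    obtain ⟨f, rfl⟩ := f
    rw [Function.comp_apply, hf]
    exact (hpairing f).mpr (h f)

end ToricCurve.IsPreLogOfType

end PreLog

section PartialFractions

variable {J : Type*} [Fintype J]

/-- The residue at `z = a j` of the quotient of the quadratic differential
`∑ R j i dz² / ((z - a j) (z - a i))` by `dz`, up to the contribution of the diagonal of `R`. The
term `i = j` of the sum is `0`, as a division by `0`. -/
def simpleResidue {k : Type*} [Field k] (a : J → k) (R : J → J → k) (j : J) : k :=
  ∑ i, (R i j + R j i) / (a j - a i)

lemma sum_simpleResidue {k : Type*} [Field k] [CharZero k] [DecidableEq J] (a : J → k)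
    (R : J → J → k) (K : Finset J) :
    ∑ j ∈ K, simpleResidue a R j = ∑ j ∈ K, ∑ i ∈ Kᶜ, (R i j + R j i) / (a j - a i) := by
  have hanti : ∑ j ∈ K, ∑ i ∈ K, (R i j + R j i) / (a j - a i) = 0 := by
    refine self_eq_neg.mp (Finset.sum_comm.trans ?_)
    simp_rw [← Finset.sum_neg_distrib]
    refine Finset.sum_congr rfl fun i _ => Finset.sum_congr rfl fun j _ => ?_
    rw [← div_neg, neg_sub, add_comm]
  simp only [simpleResidue, ← Finset.sum_add_sum_compl K, Finset.sum_add_distrib, hanti, zero_add]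

lemma eta_mul_eta {a b : ℂ} (hab : a ≠ b) :
    eta (OnePoint.some a) * eta (OnePoint.some b) =
      (a - b)⁻¹ • (eta (OnePoint.some a) - eta (OnePoint.some b)) := by
  have ha := X_sub_C_ne_zero a
  have hb := X_sub_C_ne_zero b
  have hC : (RatFunc.C a - RatFunc.C b : RatFunc ℂ) ≠ 0 := by
    rw [← map_sub]
    exact (map_ne_zero _).mpr (sub_ne_zero.mpr hab)
  simp only [eta, RatFunc.smul_eq_C_mul, map_inv₀, map_sub]
  field_simp
  ring

variable {a : J → ℂ} (ha : a.Injective) {R : J → J → ℂ}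
include ha

lemma sum_smul_eta_mul_eta (hR : ∀ j, R j j = 0) :
    ∑ i, (∑ j, R j i • eta (OnePoint.some (a j))) * eta (OnePoint.some (a i)) =
      ∑ j, simpleResidue a R j • eta (OnePoint.some (a j)) := by
  have hprod (i j) : R j i • eta (OnePoint.some (a j)) * eta (OnePoint.some (a i)) =
      (R j i / (a j - a i)) • eta (OnePoint.some (a j)) +
        (R j i / (a i - a j)) • eta (OnePoint.some (a i)) := by
    obtain rfl | hij := eq_or_ne j i
    · simp [hR]
    · rw [smul_mul_assoc, eta_mul_eta (ha.ne hij), smul_smul, ← div_eq_mul_inv, ← neg_sub (a j),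
        div_neg]
      module
  simp_rw [Finset.sum_mul, hprod, Finset.sum_add_distrib]
  rw [Finset.sum_comm]
  simp_rw [← Finset.sum_smul, ← Finset.sum_add_distrib, ← add_smul, ← Finset.sum_add_distrib,
    ← add_div, simpleResidue]
  refine Finset.sum_congr rfl fun j _ => ?_
  congr! 3 with i
  exact add_comm _ _

lemma residue_sum_smul_eta_coe (c : J → ℂ) (j : J) :
    residue (OnePoint.some (a j)) (∑ i, c i • eta (OnePoint.some (a i))) = c j := by
  classical
  simp [residue_sum_smul, residue_eta, ha.eq_iff]

lemma sum_smul_eta_mul_eta_eq_zero_iff :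
    ∑ i, (∑ j, R j i • eta (OnePoint.some (a j))) * eta (OnePoint.some (a i)) = 0 ↔
      (∀ j, R j j = 0) ∧ ∀ j, simpleResidue a R j = 0 := by
  classical
  constructor
  · intro h
    have hdiag (j) : R j j = 0 := by
      have hpairing := sum_residue_mul_residue_eq_zero (x := OnePoint.some (a j))
        (fun i => expandForm_sum_smul_eta_mem _ _) (fun i => expandForm_eta_mem _ _) h
      simpa [residue_sum_smul_eta_coe ha, residue_eta, ha.eq_iff] using hpairing
    refine ⟨hdiag, fun j => ?_⟩
    rw [sum_smul_eta_mul_eta ha hdiag] at h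
    rw [← residue_sum_smul_eta_coe ha (simpleResidue a R) j, h, ← residueHom_apply, map_zero]
  · rintro ⟨hdiag, hsimple⟩
    simp [sum_smul_eta_mul_eta ha hdiag, hsimple]

end PartialFractions

section Line

variable {r : ℕ} {p : Fin (r + 1) → LaurentSeries ℂ} {t : ℂ}

lemma dlog_lineCurve_coord (hp0 : p 0 = 0) (u : Unit) (i : Fin (r + 1)) :
    dlog ((lineCurve p t).coord u i) = eta (OnePoint.some (value (p i) t)) := by
  obtain rfl | hi := eq_or_ne i 0
  · have hcoord : (lineCurve p t).coord u 0 = algebraMap (Polynomial ℂ) _ Polynomial.X := by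
      simp [lineCurve]
    simp [hcoord, dlog, eta, hp0, value]
  · have hcoord : (lineCurve p t).coord u i = algebraMap (Polynomial ℂ) (RatFunc ℂ)
        (-(Polynomial.X - Polynomial.C (value (p i) t))) := by
      simp [lineCurve, hi]
    have hne : (lineCurve p t).coord u i ≠ 0 := by
      rw [hcoord, map_ne_zero_iff _ (RatFunc.algebraMap_injective ℂ), neg_ne_zero]
      exact Polynomial.X_sub_C_ne_zero _
    rw [dlog_eq_sum_eta hne, hcoord, RatFunc.num_algebraMap, RatFunc.denom_algebraMap,
      Polynomial.roots_neg, Polynomial.roots_X_sub_C]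
    simp

lemma lineCurve_componentPt_injective (ha : Function.Injective fun i => value (p i) t) (u : Unit) :
    ((lineCurve p t).componentPt u).Injective := by
  rintro ⟨_ | i, _⟩ ⟨_ | j, _⟩ h
  · rfl
  · exact absurd h (OnePoint.infty_ne_coe _)
  · exact absurd h (OnePoint.coe_ne_infty _)
  · exact Subtype.ext (congrArg some (ha (OnePoint.coe_injective h)))

lemma isFlow_starGraph_iff {ρ : Option (Fin (r + 1)) → ℂ} :
    (starGraph r).IsFlow ρ ↔ ρ none + ∑ j, ρ (some j) = 0 := by
  classical
  rw [← Fintype.sum_option]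
  exact ⟨fun h => by simpa [starGraph] using h.conserved (),
    fun h => ⟨fun f hf => absurd rfl hf, fun u => by simpa [starGraph] using h⟩⟩

lemma starGraph_isFlowFrame : (starGraph r).IsFlowFrame (starDir r) some := by
  refine ⟨fun j => isFlow_starGraph_iff.mpr ?_, fun j => rfl, fun ρ hρ f => ?_⟩
  · simp [starDir, Pi.single_apply]
  · cases f with
    | none => simp [starDir, eq_neg_of_add_eq_zero_left (isFlow_starGraph_iff.mp hρ)]
    | some j => simp [starDir, Pi.single_apply]

lemma lineCurve_formsOfResidues (ρ : Option (Fin (r + 1)) → Fin (r + 1) → ℂ) (u : Unit)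
    (i : Fin (r + 1)) : (lineCurve p t).formsOfResidues ρ u i =
      ∑ j, ρ (some j) i • eta (OnePoint.some (value (p j) t)) := by
  classical
  refine (Finset.sum_subtype Finset.univ (fun _ => by simp [starGraph])
    fun g => ρ g i • eta ((lineCurve p t).pt g)).symm.trans ?_
  rw [Fintype.sum_option]
  simp [lineCurve, eta]

lemma sum_lineCurve_formsOfResidues_eq_zero_iff (hp0 : p 0 = 0)
    (ha : Function.Injective fun i => value (p i) t) (R : Fin (r + 1) → Fin (r + 1) → ℂ) :
    (∀ u, ∑ i, (lineCurve p t).formsOfResidues (flowResidue (starDir r) R) u i *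
      dlog ((lineCurve p t).coord u i) = 0) ↔
      (∀ j, R j j = 0) ∧ ∀ j, simpleResidue (fun i => value (p i) t) R j = 0 := by
  simp_rw [dlog_lineCurve_coord hp0, lineCurve_formsOfResidues,
    starGraph_isFlowFrame.flowResidue_leaf, sum_smul_eta_mul_eta_eq_zero_iff ha, forall_const]

end Line

section MinTwiceLocus

open Filter Topology

variable {J : Type*} {d : J → J → ℝ} {x u : J → ℝ} {i j : J}

/-- The points at which every three-term tropical polynomial `X_i ⊕ X_j ⊕ d i j` attains its
minimum twice: the tropical line with the mutual distances `d` between its ends. -/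
def minTwiceLocus (d : J → J → ℝ) : Set (J → ℝ) :=
  {x | ∀ i j, i ≠ j → MinAttainedTwice (x i) (x j) (d i j)}

lemma eq_of_mem_minTwiceLocus_of_lt (hx : x ∈ minTwiceLocus d) (hij : x i < x j) :
    x i = d i j := by
  rcases hx i j (by rintro rfl; exact hij.false) with ⟨h, -⟩ | ⟨h, -⟩ | ⟨-, h⟩ <;> linarith

lemma le_of_mem_minTwiceLocus_of_eq (hx : x ∈ minTwiceLocus d) (hne : i ≠ j) (hij : x i = x j) :
    x i ≤ d i j := by
  rcases hx i j hne with ⟨-, h⟩ | ⟨h, -⟩ | ⟨h, -⟩ <;> linarith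

/-- The direction `u` points from `x` into the tropical line. -/
def IsTangent (d : J → J → ℝ) (x u : J → ℝ) : Prop :=
  ∀ᶠ s : ℝ in 𝓝[>] 0, x + s • u ∈ minTwiceLocus d

lemma IsTangent.eq_zero_of_lt (hu : IsTangent d x u) (hx : x ∈ minTwiceLocus d)
    (hij : x i < x j) : u i = 0 := by
  have hlt : ∀ᶠ s : ℝ in 𝓝[>] 0, (x + s • u) i < (x + s • u) j :=
    (ContinuousAt.eventually_lt (f := fun s : ℝ => (x + s • u) i) (g := fun s => (x + s • u) j)
      (by simp only [Pi.add_apply, Pi.smul_apply]; fun_prop)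
      (by simp only [Pi.add_apply, Pi.smul_apply]; fun_prop)
      (by simpa using hij)).filter_mono nhdsWithin_le_nhds
  obtain ⟨s, hs, hmem, hs0⟩ := (hlt.and (hu.and self_mem_nhdsWithin)).exists
  have h := (eq_of_mem_minTwiceLocus_of_lt hmem hs).trans
    (eq_of_mem_minTwiceLocus_of_lt hx hij).symm
  simpa [ne_of_gt (show 0 < s from hs0)] using h

lemma IsTangent.eq_zero_and_dist_eq (hu : IsTangent d x u) (hij : x i = x j) (hlt : u i < u j) :
    u i = 0 ∧ d i j = x i := by
  have hconst : ∀ᶠ s : ℝ in 𝓝[>] 0, x i + s * u i = d i j := by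
    filter_upwards [hu, self_mem_nhdsWithin] with s hmem hs
    exact eq_of_mem_minTwiceLocus_of_lt hmem
      (by simpa [hij] using mul_lt_mul_of_pos_left hlt (Set.mem_Ioi.mp hs))
  have hlim : Tendsto (fun s : ℝ => x i + s * u i) (𝓝[>] 0) (𝓝 (x i + 0 * u i)) :=
    (Continuous.tendsto (by fun_prop) 0).mono_left nhdsWithin_le_nhds
  have hd : d i j = x i := by
    simpa using tendsto_nhds_unique (tendsto_const_nhds.congr' (hconst.mono fun _ => Eq.symm)) hlim
  obtain ⟨s, hs, hs0⟩ := (hconst.and self_mem_nhdsWithin).exists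
  exact ⟨by simpa [hd, ne_of_gt (show 0 < s from hs0)] using hs, hd⟩

lemma IsTangent.lt_dist_of_pos (hu : IsTangent d x u) (hne : i ≠ j) (hij : x i = x j)
    (huij : u i = u j) (hpos : 0 < u i) : x i < d i j := by
  obtain ⟨s, hmem, hs⟩ := (hu.and self_mem_nhdsWithin).exists
  have h := le_of_mem_minTwiceLocus_of_eq hmem hne (by simp [hij, huij])
  have := mul_pos (Set.mem_Ioi.mp hs) hpos
  simp only [Pi.add_apply, Pi.smul_apply, smul_eq_mul] at h
  linarith

variable [Fintype J]

open Classical in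
/-- The indices of the maximal coordinates of `x`. -/
def argmax (x : J → ℝ) : Finset J := {i | ∀ j, x j ≤ x i}

lemma mem_argmax : i ∈ argmax x ↔ ∀ j, x j ≤ x i := by
  simp [argmax]

lemma eq_of_mem_argmax (hi : i ∈ argmax x) (hj : j ∈ argmax x) : x i = x j :=
  le_antisymm (mem_argmax.mp hj i) (mem_argmax.mp hi j)

lemma lt_of_notMem_argmax (hi : i ∈ argmax x) (hj : j ∉ argmax x) : x j < x i := by
  by_contra! h
  exact hj (mem_argmax.mpr fun k => (mem_argmax.mp hi k).trans h)

lemma argmax_nonempty [Nonempty J] (x : J → ℝ) : (argmax x).Nonempty :=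
  (Finite.exists_max x).imp fun _ => mem_argmax.mpr

lemma eq_min_of_mem_argmax (hx : x ∈ minTwiceLocus d) (hi : i ∈ argmax x) (hj : j ≠ i) :
    x j = min (x i) (d j i) := by
  rcases (mem_argmax.mp hi j).lt_or_eq with h | h
  · rw [← eq_of_mem_minTwiceLocus_of_lt hx h, min_eq_right h.le]
  · rw [min_eq_left (h ▸ le_of_mem_minTwiceLocus_of_eq hx hj h), h]

/-- A set of ends of the tropical line in the same branch above the point `x`: these ends are
separated from each other only above `x`, and from the other ends above `x` exactly at `x`. -/
structure IsBranch (d : J → J → ℝ) (x : J → ℝ) (K : Finset J) : Prop where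
  nonempty : K.Nonempty
  subset : K ⊆ argmax x
  dist_across : ∀ i ∈ K, ∀ j ∈ argmax x, j ∉ K → d j i = x i
  dist_within : ∀ i ∈ K, ∀ j ∈ K, i ≠ j → x i < d i j

lemma IsTangent.eq_neg_argmax_or_branch [DecidableEq J] (hu : IsTangent d x u)
    (hx : x ∈ minTwiceLocus d) (hu0 : u ≠ 0) : (∃ c < 0, ∀ i, u i = if i ∈ argmax x then c else 0) ∨
      ∃ c > 0, ∃ K, IsBranch d x K ∧ ∀ i, u i = if i ∈ K then c else 0 := by
  obtain ⟨i₀, -⟩ := Function.ne_iff.mp hu0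
  have hne : (argmax x).Nonempty := @argmax_nonempty _ _ ⟨i₀⟩ x
  have hout (i) (hi : i ∉ argmax x) : u i = 0 :=
    hne.elim fun j hj => hu.eq_zero_of_lt hx (lt_of_notMem_argmax hj hi)
  obtain ⟨m, hm, hmax⟩ := Finset.exists_max_image (argmax x) u hne
  have hlower (i) (hi : i ∈ argmax x) (him : u i ≠ u m) : u i = 0 :=
    (hu.eq_zero_and_dist_eq (eq_of_mem_argmax hi hm) ((hmax i hi).lt_of_ne him)).1
  rcases lt_or_ge 0 (u m) with hpos | hneg
  · refine Or.inr ⟨u m, hpos, {i ∈ argmax x | u i = u m},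
      ⟨⟨m, by simp [hm]⟩, Finset.filter_subset _ _, ?_, ?_⟩, fun i => ?_⟩
    · intro i hi j hj hjK
      obtain ⟨hi, hum⟩ := Finset.mem_filter.mp hi
      have hlt : u j < u i := hum ▸ (hmax j hj).lt_of_ne fun h => hjK (by simp [hj, h])
      rw [(hu.eq_zero_and_dist_eq (eq_of_mem_argmax hj hi) hlt).2, eq_of_mem_argmax hj hi]
    · intro i hi j hj hij
      obtain ⟨⟨hi, hui⟩, hj, huj⟩ := And.intro (Finset.mem_filter.mp hi) (Finset.mem_filter.mp hj)
      exact hu.lt_dist_of_pos hij (eq_of_mem_argmax hi hj) (hui.trans huj.symm) (hui ▸ hpos)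
    · grind
  · have heq (i) (hi : i ∈ argmax x) : u i = u m := by
      by_contra him
      exact (((hmax i hi).lt_of_ne him).trans_le hneg).ne (hlower i hi him)
    refine Or.inl ⟨u m, hneg.lt_of_ne fun h => hu0 (funext fun i => ?_), fun i => ?_⟩
    · by_cases hi : i ∈ argmax x
      · rw [heq i hi, h, Pi.zero_apply]
      · exact hout i hi
    · grind

end MinTwiceLocus

namespace TropicalCurve

open Filter Topology

variable {n : ℕ} {V F : Type*} [Fintype V] [Fintype F] {Γ : TropicalCurve n V F}
  {d : Fin n → Fin n → ℝ} {f g : F} {v w : V} {i j : Fin n}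

lemma dir_ne_zero (Γ : TropicalCurve n V F) (f : F) : Γ.dir f ≠ 0 := by
  intro h
  have := Γ.dir_primitive f
  rw [h, Finset.gcd_eq_zero_iff.mpr (by simp)] at this
  exact zero_ne_one this

lemma eventually_mem_openEdge (Γ : TropicalCurve n V F) (f : F) : ∀ᶠ s : ℝ in 𝓝[>] 0,
    (Γ.pos (Γ.vert f) + s • fun i => (Γ.dir f i : ℝ)) ∈ Γ.openEdge f := by
  by_cases h : Γ.opp f = f
  · filter_upwards [self_mem_nhdsWithin] with s hs using
      ⟨s, hs, fun h' => absurd h h', fun _ => rfl⟩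
  · filter_upwards [Ioo_mem_nhdsGT (Γ.len_pos f h)] with s hs using
      ⟨s, hs.1, fun _ => hs.2, fun _ => rfl⟩

lemma mem_openEdge_of_unbounded (hf : Γ.opp f = f) {s : ℝ} (hs : 0 < s) :
    (Γ.pos (Γ.vert f) + s • fun i => (Γ.dir f i : ℝ)) ∈ Γ.openEdge f :=
  ⟨s, hs, fun h => absurd hf h, fun _ => rfl⟩

lemma eq_of_vert_eq_of_dir_eq (hemb : Γ.IsEmbedded) (hv : Γ.vert f = Γ.vert g)
    (hd : Γ.dir f = Γ.dir g) : f = g := by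
  by_contra hne
  have hopp : g ≠ Γ.opp f := by
    rintro rfl
    refine Γ.dir_ne_zero f (funext fun i => ?_)
    have := Γ.dir_opp f (Ne.symm hne) i
    rw [← hd] at this
    simp only [Pi.zero_apply]
    lia
  obtain ⟨s, hsf, hsg⟩ := ((Γ.eventually_mem_openEdge f).and (Γ.eventually_mem_openEdge g)).exists
  rw [← hv, ← hd] at hsg
  exact Set.disjoint_left.mp (hemb.2.2 f g (Ne.symm hne) hopp) hsf hsg

lemma eq_one_or_neg_one_of_dir_eq {K : Finset (Fin n)} {c : ℝ}
    (h : ∀ i, (Γ.dir f i : ℝ) = if i ∈ K then c else 0) (hK : K.Nonempty) : c = 1 ∨ c = -1 := by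
  obtain ⟨m, hm⟩ := hK
  have hc : (Γ.dir f m : ℝ) = c := by simpa [hm] using h m
  have hdvd : Γ.dir f m ∣ 1 := by
    rw [← Γ.dir_primitive f]
    refine Finset.dvd_gcd fun i _ => ?_
    have hi : Γ.dir f i = if i ∈ K then Γ.dir f m else 0 := by
      have := h i
      rw [← hc] at this
      split_ifs at this ⊢ <;> exact_mod_cast this
    rw [hi]
    split_ifs <;> simp
  rw [← hc]
  exact_mod_cast Int.isUnit_iff.mp (isUnit_of_dvd_one hdvd)

lemma sum_dir_opp (hf : Γ.opp f ≠ f) : ∑ i, Γ.dir (Γ.opp f) i = -∑ i, Γ.dir f i := by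
  simp_rw [Γ.dir_opp f hf, Finset.sum_neg_distrib]

open Classical in
lemma sum_dir_eq_zero (hwt : ∀ f, Γ.wt f = 1) (v : V) (i : Fin n) :
    ∑ f with Γ.vert f = v, Γ.dir f i = 0 := by
  simpa [hwt] using Γ.balanced v i

lemma isFlow_dir (hwt : ∀ f, Γ.wt f = 1) (i : Fin n) :
    Γ.IsFlow fun f => (Γ.dir f i : ℂ) :=
  ⟨fun f hf => by simp [Γ.dir_opp f hf], fun v => by exact_mod_cast sum_dir_eq_zero hwt v i⟩

section TropicalLine

variable (himg : Γ.image = minTwiceLocus d)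
include himg

lemma pos_mem_minTwiceLocus (v : V) : Γ.pos v ∈ minTwiceLocus d :=
  himg ▸ Or.inl ⟨v, rfl⟩

lemma openEdge_subset_minTwiceLocus (f : F) : Γ.openEdge f ⊆ minTwiceLocus d :=
  himg ▸ fun _ hx => Or.inr (Set.mem_iUnion.mpr ⟨f, hx⟩)

lemma dir_eq_neg_argmax_or_branch (f : F) :
    (∀ i, Γ.dir f i = if i ∈ argmax (Γ.pos (Γ.vert f)) then -1 else 0) ∨
      ∃ K, IsBranch d (Γ.pos (Γ.vert f)) K ∧ ∀ i, Γ.dir f i = if i ∈ K then 1 else 0 := by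
  obtain ⟨i₀, hi₀⟩ := Function.ne_iff.mp (Γ.dir_ne_zero f)
  have htan : IsTangent d (Γ.pos (Γ.vert f)) fun i => (Γ.dir f i : ℝ) :=
    (Γ.eventually_mem_openEdge f).mono fun _ hs => openEdge_subset_minTwiceLocus himg f hs
  have hne : (fun i => (Γ.dir f i : ℝ)) ≠ 0 :=
    Function.ne_iff.mpr ⟨i₀, by simpa using hi₀⟩
  rcases htan.eq_neg_argmax_or_branch (pos_mem_minTwiceLocus himg _) hne with
    ⟨c, hc, h⟩ | ⟨c, hc, K, hK, h⟩
  · obtain rfl : c = -1 :=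
      (eq_one_or_neg_one_of_dir_eq h (@argmax_nonempty _ _ ⟨i₀⟩ _)).resolve_left (by linarith)
    exact Or.inl fun i => by exact_mod_cast h i
  · obtain rfl : c = 1 := (eq_one_or_neg_one_of_dir_eq h hK.nonempty).resolve_right (by linarith)
    exact Or.inr ⟨K, hK, fun i => by exact_mod_cast h i⟩

lemma exists_branch_of_dir_pos (hj : 0 < Γ.dir f j) :
    ∃ K, IsBranch d (Γ.pos (Γ.vert f)) K ∧ j ∈ K ∧ ∀ i, Γ.dir f i = if i ∈ K then 1 else 0 := by
  rcases dir_eq_neg_argmax_or_branch himg f with h | ⟨K, hK, h⟩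
  · have := h j
    split_ifs at this <;> lia
  · refine ⟨K, hK, ?_, h⟩
    by_contra hjK
    simp [h, hjK] at hj

lemma dir_eq_single_of_unbounded (hf : Γ.opp f = f) (hj : 0 < Γ.dir f j) :
    Γ.dir f = Pi.single j 1 := by
  obtain ⟨K, hK, hjK, hdir⟩ := exists_branch_of_dir_pos himg hj
  ext i
  rw [hdir, Pi.single_apply]
  refine if_congr ⟨fun hi => by_contra fun hij => ?_, fun h => h ▸ hjK⟩ rfl rfl
  -- Two ends of the branch would be joined at height `d i j`, but the ray passes that height.
  set x := Γ.pos (Γ.vert f)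
  have hs : 0 < d i j - x i + 1 := by linarith [hK.dist_within i hi j hjK hij]
  have hle : x i + (d i j - x i + 1) ≤ d i j := by
    simpa [hdir, hi, x] using le_of_mem_minTwiceLocus_of_eq
      (openEdge_subset_minTwiceLocus himg f (mem_openEdge_of_unbounded hf hs)) hij
      (by simp [hdir, hi, hjK, x, eq_of_mem_argmax (hK.subset hi) (hK.subset hjK)])
  linarith

lemma dir_eq_neg_one_of_unbounded (hf : Γ.opp f = f)
    (hdir : ∀ i, Γ.dir f i = if i ∈ argmax (Γ.pos (Γ.vert f)) then -1 else 0) (i : Fin n) :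
    Γ.dir f i = -1 := by
  rw [hdir, if_pos]
  by_contra hi
  obtain ⟨j, hj⟩ := @argmax_nonempty _ _ ⟨i⟩ (Γ.pos (Γ.vert f))
  -- Far down the ray, the coordinate `j` would be the only minimum of the term for `i` and `j`.
  set x := Γ.pos (Γ.vert f)
  obtain ⟨s, hs, hsi, hsj⟩ : ∃ s : ℝ, 0 < s ∧ x j - s < x i ∧ x j - s < d j i :=
    ⟨x j - x i + |x j - d j i| + 1,
      by linarith [lt_of_notMem_argmax hj hi, abs_nonneg (x j - d j i)],
      by linarith [abs_nonneg (x j - d j i)],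
      by linarith [lt_of_notMem_argmax hj hi, le_abs_self (x j - d j i)]⟩
  refine hsj.ne ?_
  simpa [hdir, hj, x, sub_eq_add_neg] using eq_of_mem_minTwiceLocus_of_lt (i := j) (j := i)
    (openEdge_subset_minTwiceLocus himg f (mem_openEdge_of_unbounded hf hs))
    (by simpa [hdir, hi, hj, x, sub_eq_add_neg] using hsi)

lemma pos_eq_dist_of_unbounded (hf : Γ.opp f = f) (hdir : Γ.dir f = Pi.single j 1)
    (hij : i ≠ j) : Γ.pos (Γ.vert f) i = d i j := by
  set x := Γ.pos (Γ.vert f)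
  have hs : 0 < |x i - x j| + 1 := by positivity
  have hlt : x i < x j + (|x i - x j| + 1) := by linarith [le_abs_self (x i - x j)]
  simpa [hdir, hij, x] using eq_of_mem_minTwiceLocus_of_lt (i := i) (j := j)
    (openEdge_subset_minTwiceLocus himg f (mem_openEdge_of_unbounded hf hs))
    (by simpa [hdir, hij, x] using hlt)

lemma unbounded_flag_unique (hemb : Γ.IsEmbedded) (hf : Γ.opp f = f) (hg : Γ.opp g = g)
    (hfd : Γ.dir f = Pi.single j 1) (hgd : Γ.dir g = Pi.single j 1) : f = g := by
  by_contra hne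
  have hdisj := hemb.2.2 f g (Ne.symm hne) (hf.symm ▸ Ne.symm hne)
  set a := Γ.pos (Γ.vert f) j with ha
  set b := Γ.pos (Γ.vert g) j with hb
  have hfmem := mem_openEdge_of_unbounded hf (s := max a b + 1 - a) (by linarith [le_max_left a b])
  have hgmem := mem_openEdge_of_unbounded hg (s := max a b + 1 - b) (by linarith [le_max_right a b])
  refine Set.disjoint_left.mp hdisj hfmem ?_
  convert hgmem using 1
  ext i
  by_cases hij : i = j
  · subst hij
    simp [hfd, hgd, ← ha, ← hb]
  · simp [hfd, hgd, hij, pos_eq_dist_of_unbounded himg hf hfd hij,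
      pos_eq_dist_of_unbounded himg hg hgd hij]

end TropicalLine

/-- The three flags at a vertex of a tropical line: `down` points away from all the ends above the
vertex, while `left` and `right` point towards two complementary branches `K` and `L` of these ends.
An end is chosen in either branch. -/
structure Fork (Γ : TropicalCurve n V F) (d : Fin n → Fin n → ℝ) (v : V) where
  down : F
  left : F
  right : F
  vert_iff : ∀ f, Γ.vert f = v ↔ f = down ∨ f = left ∨ f = right
  K : Finset (Fin n)
  L : Finset (Fin n)
  argmax_eq : argmax (Γ.pos v) = K ∪ L
  disjoint : Disjoint K L
  isBranch_left : IsBranch d (Γ.pos v) K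
  isBranch_right : IsBranch d (Γ.pos v) L
  dir_down : ∀ i, Γ.dir down i = if i ∈ K ∪ L then -1 else 0
  dir_left : ∀ i, Γ.dir left i = if i ∈ K then 1 else 0
  dir_right : ∀ i, Γ.dir right i = if i ∈ L then 1 else 0
  k : Fin n
  l : Fin n
  k_mem : k ∈ K
  l_mem : l ∈ L

lemma exists_flag_down (htri : Γ.IsTrivalent) (hwt : ∀ f, Γ.wt f = 1)
    (himg : Γ.image = minTwiceLocus d) (v : V) :
    ∃ f, Γ.vert f = v ∧ ∀ i, Γ.dir f i = if i ∈ argmax (Γ.pos v) then -1 else 0 := by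
  classical
  by_contra! hnone
  have hup (f) (hf : Γ.vert f = v) : ∃ K : Finset (Fin n), K.Nonempty ∧
      ∀ i, Γ.dir f i = if i ∈ K then 1 else 0 := by
    subst hf
    rcases dir_eq_neg_argmax_or_branch himg f with h | ⟨K, hK, h⟩
    · exact ((hnone f rfl).elim fun i hi => hi (h i)).elim
    · exact ⟨K, hK.nonempty, h⟩
  obtain ⟨⟨f, hf⟩⟩ : Nonempty {f // Γ.vert f = v} :=
    (Nat.card_pos_iff.mp ((htri v).symm ▸ three_pos)).1
  obtain ⟨K, ⟨k, hk⟩, hdir⟩ := hup f hf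
  refine (Finset.sum_pos' (fun g hg => ?_) ⟨f, by simpa using hf, ?_⟩).ne'
    (sum_dir_eq_zero hwt v k)
  · obtain ⟨L, -, h⟩ := hup g (by simpa using hg)
    rw [h]
    split_ifs <;> simp
  · simp [hdir, hk]

lemma exists_vert_iff_of_isTrivalent (htri : Γ.IsTrivalent) (f : F) :
    ∃ b c, f ≠ b ∧ f ≠ c ∧ b ≠ c ∧ ∀ g, Γ.vert g = Γ.vert f ↔ g = f ∨ g = b ∨ g = c := by
  classical
  have hcard := htri (Γ.vert f)
  rw [Nat.card_eq_fintype_card, Fintype.card_subtype] at hcard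
  have hmem : f ∈ Finset.univ.filter fun g => Γ.vert g = Γ.vert f := by simp
  obtain ⟨b, c, hbc, h⟩ := Finset.card_eq_two.mp
    ((Finset.card_erase_of_mem hmem).trans (by rw [hcard]))
  have hiff (g) : g ≠ f ∧ Γ.vert g = Γ.vert f ↔ g = b ∨ g = c := by
    simpa using Finset.ext_iff.mp h g
  exact ⟨b, c, ((hiff b).mpr (.inl rfl)).1.symm, ((hiff c).mpr (.inr rfl)).1.symm, hbc,
    fun g => by grind⟩

lemma nonempty_fork (htri : Γ.IsTrivalent) (hemb : Γ.IsEmbedded) (hwt : ∀ f, Γ.wt f = 1)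
    (himg : Γ.image = minTwiceLocus d) (v : V) : Nonempty (Γ.Fork d v) := by
  classical
  obtain ⟨a, rfl, ha⟩ := exists_flag_down htri hwt himg v
  obtain ⟨b, c, hab, hac, hbc, hvert⟩ := exists_vert_iff_of_isTrivalent htri a
  have hbranch (g) (hg : Γ.vert g = Γ.vert a) (hne : a ≠ g) : ∃ K,
      IsBranch d (Γ.pos (Γ.vert a)) K ∧ ∀ i, Γ.dir g i = if i ∈ K then 1 else 0 := by
    rw [← hg]
    refine (dir_eq_neg_argmax_or_branch himg g).resolve_left fun h => hne ?_
    exact eq_of_vert_eq_of_dir_eq hemb hg.symm (funext fun i => by rw [h, ha, hg])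
  obtain ⟨K, hK, hb⟩ := hbranch b ((hvert b).mpr (by simp)) hab
  obtain ⟨L, hL, hc⟩ := hbranch c ((hvert c).mpr (by simp)) hac
  obtain ⟨⟨k, hk⟩, l, hl⟩ := And.intro hK.nonempty hL.nonempty
  have hflags : (Finset.univ.filter fun g => Γ.vert g = Γ.vert a) = {a, b, c} := by
    ext g
    simp [hvert]
  have hmem (i) : (i ∈ argmax (Γ.pos (Γ.vert a)) ↔ i ∈ K ∪ L) ∧ ¬(i ∈ K ∧ i ∈ L) := by
    have hbal := sum_dir_eq_zero hwt (Γ.vert a) i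
    rw [hflags, Finset.sum_insert (by simp [hab, hac]), Finset.sum_pair hbc, ha, hb, hc] at hbal
    have := @hK.subset i
    have := @hL.subset i
    split_ifs at hbal <;> simp_all
  have hargmax : argmax (Γ.pos (Γ.vert a)) = K ∪ L := Finset.ext fun i => (hmem i).1
  exact ⟨⟨a, b, c, hvert, K, L, hargmax,
    Finset.disjoint_left.mpr fun i hi hi' => (hmem i).2 ⟨hi, hi'⟩, hK, hL,
    fun i => by rw [ha, hargmax], hb, hc, k, l, hk, hl⟩⟩

namespace Fork

variable (φ : Γ.Fork d v)

lemma notMem_right (hi : i ∈ φ.K) : i ∉ φ.L := Finset.disjoint_left.mp φ.disjoint hi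

lemma notMem_left (hi : i ∈ φ.L) : i ∉ φ.K := Finset.disjoint_right.mp φ.disjoint hi

lemma dir_down_eq_neg (i : Fin n) : Γ.dir φ.down i = -(Γ.dir φ.left i + Γ.dir φ.right i) := by
  have := φ.notMem_right (i := i)
  rw [φ.dir_down, φ.dir_left, φ.dir_right]
  grind

lemma sum_dir_left : ∑ i, Γ.dir φ.left i = φ.K.card := by
  simp [φ.dir_left]

lemma sum_dir_right : ∑ i, Γ.dir φ.right i = φ.L.card := by
  simp [φ.dir_right]

lemma sum_dir_down : ∑ i, Γ.dir φ.down i = -(φ.K.card + φ.L.card) := by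
  simp only [dir_down_eq_neg, Finset.sum_neg_distrib, Finset.sum_add_distrib, sum_dir_left,
    sum_dir_right]

lemma card_left_pos : 0 < φ.K.card := φ.isBranch_left.nonempty.card_pos

lemma card_right_pos : 0 < φ.L.card := φ.isBranch_right.nonempty.card_pos

lemma eq_down_of_sum_dir_neg (hf : Γ.vert f = v) (hneg : ∑ i, Γ.dir f i < 0) : f = φ.down := by
  rcases (φ.vert_iff f).mp hf with rfl | rfl | rfl
  · rfl
  · rw [φ.sum_dir_left] at hneg
    lia
  · rw [φ.sum_dir_right] at hneg
    lia

lemma eq_left_or_right_of_sum_dir_pos (hf : Γ.vert f = v) (hpos : 0 < ∑ i, Γ.dir f i) :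
    f = φ.left ∨ f = φ.right := by
  refine ((φ.vert_iff f).mp hf).resolve_left ?_
  rintro rfl
  rw [φ.sum_dir_down] at hpos
  lia

lemma flow_down_eq_neg {ρ : F → ℂ} (hρ : Γ.IsFlow ρ) :
    ρ φ.down = -(ρ φ.left + ρ φ.right) := by
  classical
  have hk : φ.k ∉ φ.L := φ.notMem_right φ.k_mem
  have hflags : (Finset.univ.filter fun f => Γ.vert f = v) = {φ.down, φ.left, φ.right} := by
    ext f
    simp [φ.vert_iff]
  have hdl : φ.down ≠ φ.left := fun h => by
    simpa [φ.dir_down, φ.dir_left, φ.k_mem] using congrArg (Γ.dir · φ.k) h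
  have hdr : φ.down ≠ φ.right := fun h => by
    simpa [φ.dir_down, φ.dir_right, φ.l_mem] using congrArg (Γ.dir · φ.l) h
  have hlr : φ.left ≠ φ.right := fun h => by
    simpa [φ.dir_left, φ.dir_right, φ.k_mem, hk] using congrArg (Γ.dir · φ.k) h
  rw [eq_neg_iff_add_eq_zero, ← hρ.conserved v, hflags,
    Finset.sum_insert (by simp [hdl, hdr]), Finset.sum_pair hlr]

lemma mem_argmax_of_mem (hi : i ∈ φ.K ∨ i ∈ φ.L) : i ∈ argmax (Γ.pos v) := by
  rwa [φ.argmax_eq, Finset.mem_union]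

lemma dist_of_across (h : i ∈ φ.K ∧ j ∈ φ.L ∨ i ∈ φ.L ∧ j ∈ φ.K) : d i j = Γ.pos v i := by
  have hi : i ∈ argmax (Γ.pos v) := φ.mem_argmax_of_mem (by tauto)
  have hj : j ∈ argmax (Γ.pos v) := φ.mem_argmax_of_mem (by tauto)
  rw [eq_of_mem_argmax hi hj]
  rcases h with ⟨hiK, hjL⟩ | ⟨hiL, hjK⟩
  · exact φ.isBranch_right.dist_across j hjL i hi (φ.notMem_right hiK)
  · exact φ.isBranch_left.dist_across j hjK i hi (φ.notMem_left hiL)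

lemma dist_lt_of_outside (himg : Γ.image = minTwiceLocus d) (hi : i ∈ φ.K) (hjK : j ∉ φ.K)
    (hjL : j ∉ φ.L) : d j i < Γ.pos v i := by
  have hji : Γ.pos v j < Γ.pos v i :=
    lt_of_notMem_argmax (φ.mem_argmax_of_mem (Or.inl hi)) (by simp [φ.argmax_eq, hjK, hjL])
  rwa [eq_of_mem_minTwiceLocus_of_lt (pos_mem_minTwiceLocus himg v) hji] at hji

lemma vertex_unique (hemb : Γ.IsEmbedded) (himg : Γ.image = minTwiceLocus d) (ψ : Γ.Fork d w)
    (hφ : i ∈ φ.K ∧ j ∈ φ.L ∨ i ∈ φ.L ∧ j ∈ φ.K) (hψ : i ∈ ψ.K ∧ j ∈ ψ.L ∨ i ∈ ψ.L ∧ j ∈ ψ.K) :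
    v = w := by
  have hheight : Γ.pos v i = Γ.pos w i := by rw [← φ.dist_of_across hφ, ψ.dist_of_across hψ]
  have hi : i ∈ argmax (Γ.pos v) := φ.mem_argmax_of_mem (by tauto)
  have hi' : i ∈ argmax (Γ.pos w) := ψ.mem_argmax_of_mem (by tauto)
  refine hemb.1 (funext fun m => ?_)
  by_cases hm : m = i
  · rw [hm, hheight]
  · rw [eq_min_of_mem_argmax (pos_mem_minTwiceLocus himg v) hi hm,
      eq_min_of_mem_argmax (pos_mem_minTwiceLocus himg w) hi' hm, hheight]

end Fork

section Induction

variable (himg : Γ.image = minTwiceLocus d) (φ : ∀ v, Γ.Fork d v)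
include himg

/-- Induction from the ends of a tropical line towards its root, on the number of ends above. -/
lemma flag_induction {P : F → Prop}
    (leaf : ∀ f j, Γ.opp f = f → Γ.dir f = Pi.single j 1 → P f)
    (opp : ∀ f, Γ.opp f ≠ f → P (Γ.opp f) → P f)
    (down : ∀ v, P (φ v).left → P (φ v).right → P (φ v).down) (f : F) : P f := by
  have up (N : ℕ) : ∀ f, ∑ i, Γ.dir f i = N → 0 < N → P f := by
    induction N using Nat.strong_induction_on with
    | _ N ih =>
      intro f hN hpos
      by_cases hf : Γ.opp f = f
      · obtain ⟨j, -, hj⟩ := Finset.exists_lt_of_sum_lt (s := Finset.univ) (f := fun _ => 0)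
          (g := Γ.dir f) (by simpa [hN] using hpos)
        exact leaf f j hf (dir_eq_single_of_unbounded himg hf hj)
      · let ψ := φ (Γ.vert (Γ.opp f))
        have hsum := sum_dir_opp hf
        have hdown : Γ.opp f = ψ.down := ψ.eq_down_of_sum_dir_neg rfl (by lia)
        rw [hdown, ψ.sum_dir_down] at hsum
        have hK := ψ.card_left_pos
        have hL := ψ.card_right_pos
        refine opp f hf (hdown ▸ down _ ?_ ?_)
        · exact ih ψ.K.card (by lia) _ ψ.sum_dir_left hK
        · exact ih ψ.L.card (by lia) _ ψ.sum_dir_right hL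
  have left (v) : P (φ v).left := up _ _ (φ v).sum_dir_left (φ v).card_left_pos
  have right (v) : P (φ v).right := up _ _ (φ v).sum_dir_right (φ v).card_right_pos
  rcases ((φ (Γ.vert f)).vert_iff f).mp rfl with h | h | h <;> rw [h]
  exacts [down _ (left _) (right _), left _, right _]

omit himg in
lemma Fork.card_add_card_le (ψ : Γ.Fork d v) : ψ.K.card + ψ.L.card ≤ n := by
  simpa [Finset.card_union_of_disjoint ψ.disjoint] using (ψ.K ∪ ψ.L).card_le_univ

/-- Induction from the root of a tropical line towards its ends, on the number of ends above. -/
lemma down_induction {P : F → Prop} (root : ∀ f, (∀ i, Γ.dir f i = -1) → P f)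
    (left : ∀ v, Γ.opp (φ v).left ≠ (φ v).left → P (φ v).down → P (Γ.opp (φ v).left))
    (right : ∀ v, Γ.opp (φ v).right ≠ (φ v).right → P (φ v).down → P (Γ.opp (φ v).right))
    (v : V) : P (φ v).down := by
  induction hN : n - ((φ v).K.card + (φ v).L.card) using Nat.strong_induction_on generalizing v with
  | _ N ih =>
    by_cases hopp : Γ.opp (φ v).down = (φ v).down
    · refine root _ (dir_eq_neg_one_of_unbounded himg hopp fun i => ?_)
      rw [(φ v).dir_down, (φ v).vert_iff _ |>.mpr (.inl rfl), (φ v).argmax_eq]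
    · let ψ := φ (Γ.vert (Γ.opp (φ v).down))
      have hopp' : Γ.opp (Γ.opp (φ v).down) = (φ v).down := Γ.opp_opp _
      have hsum := sum_dir_opp hopp
      rw [(φ v).sum_dir_down] at hsum
      have hv := (φ v).card_left_pos
      have hK := ψ.card_left_pos
      have hL := ψ.card_right_pos
      have hle := ψ.card_add_card_le
      rw [← hopp'] at hopp ⊢
      rcases ψ.eq_left_or_right_of_sum_dir_pos rfl (by lia) with h | h
      · rw [h, ψ.sum_dir_left] at hsum
        rw [h] at hopp ⊢
        exact left _ (Ne.symm (by simpa [Γ.opp_opp] using hopp)) (ih _ (by lia) _ rfl)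
      · rw [h, ψ.sum_dir_right] at hsum
        rw [h] at hopp ⊢
        exact right _ (Ne.symm (by simpa [Γ.opp_opp] using hopp)) (ih _ (by lia) _ rfl)

end Induction

lemma flow_ext (hemb : Γ.IsEmbedded) (himg : Γ.image = minTwiceLocus d) (φ : ∀ v, Γ.Fork d v)
    {leaf : Fin n → F} (hleaf : ∀ j, Γ.opp (leaf j) = leaf j)
    (hdir : ∀ j, Γ.dir (leaf j) = Pi.single j 1) {ρ σ : F → ℂ} (hρ : Γ.IsFlow ρ)
    (hσ : Γ.IsFlow σ) (h : ∀ j, ρ (leaf j) = σ (leaf j)) (f : F) : ρ f = σ f := by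
  induction f using flag_induction himg φ with
  | leaf f j hf hfd => rw [unbounded_flag_unique himg hemb hf (hleaf j) hfd (hdir j), h]
  | opp f hf ih => rwa [hρ.opp f hf, hσ.opp f hf, neg_inj] at ih
  | down v hl hr => rw [(φ v).flow_down_eq_neg hρ, (φ v).flow_down_eq_neg hσ, hl, hr]

lemma isFlowFrame (hwt : ∀ f, Γ.wt f = 1) (hemb : Γ.IsEmbedded)
    (himg : Γ.image = minTwiceLocus d) (φ : ∀ v, Γ.Fork d v) {leaf : Fin n → F}
    (hleaf : ∀ j, Γ.opp (leaf j) = leaf j) (hdir : ∀ j, Γ.dir (leaf j) = Pi.single j 1) :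
    Γ.IsFlowFrame Γ.dir leaf where
  isFlow := isFlow_dir hwt
  dir_leaf := hdir
  eq_sum ρ hρ := flow_ext hemb himg φ hleaf hdir hρ
    (FlagGraph.IsFlow.sum_mul (isFlow_dir hwt) fun j => ρ (leaf j))
    fun j => by simp [hdir, Pi.single_apply]

section Linear

variable (himg : Γ.image = minTwiceLocus d) (φ : ∀ v, Γ.Fork d v)
include himg

lemma flow_eq_zero_of_left_eq_zero {ρ : F → ℂ} (hρ : Γ.IsFlow ρ)
    (hroot : ∀ f, (∀ i, Γ.dir f i = -1) → ρ f = 0) (hleft : ∀ v, ρ (φ v).left = 0) (f : F) :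
    ρ f = 0 := by
  have hright {v} (h : ρ (φ v).down = 0) : ρ (φ v).right = 0 := by
    simpa [h, hleft] using (φ v).flow_down_eq_neg hρ
  have hdown (v) : ρ (φ v).down = 0 :=
    down_induction himg φ (P := fun f => ρ f = 0) hroot
      (fun v hv _ => by rw [hρ.opp _ hv, hleft, neg_zero])
      (fun v hv h => by rw [hρ.opp _ hv, hright h, neg_zero]) v
  rcases ((φ (Γ.vert f)).vert_iff f).mp rfl with h | h | h <;> rw [h]
  exacts [hdown _, hleft _, hright (hdown _)]

lemma eq_zero_of_sum_left_eq_zero (hwt : ∀ f, Γ.wt f = 1) {leaf : Fin n → F}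
    (hdir : ∀ j, Γ.dir (leaf j) = Pi.single j 1) {c : Fin n → ℂ} (hc : ∑ i, c i = 0)
    (hleft : ∀ v, ∑ i ∈ (φ v).K, c i = 0) (j : Fin n) : c j = 0 := by
  have hflow : Γ.IsFlow fun f => ∑ i, (Γ.dir f i : ℂ) * c i :=
    FlagGraph.IsFlow.sum_mul (isFlow_dir hwt) c
  have hzero := flow_eq_zero_of_left_eq_zero himg φ hflow (fun f hf => by simp [hf, hc])
    (fun v => by simpa [(φ v).dir_left, ite_mul] using hleft v) (leaf j)
  simpa [hdir, Pi.single_apply] using hzero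

lemma sum_flowResidue_mul_dir_eq_zero_iff {leaf : Fin n → F}
    (hdir : ∀ j, Γ.dir (leaf j) = Pi.single j 1) (R : Fin n → Fin n → ℂ) :
    (∀ f, ∑ i, flowResidue Γ.dir R f i * Γ.dir f i = 0) ↔
      (∀ j, R j j = 0) ∧ ∀ v, ∑ i ∈ (φ v).K, ∑ j ∈ (φ v).L, (R i j + R j i) = 0 := by
  let u : F → Fin n → ℂ := fun f i => Γ.dir f i
  let B := Matrix.toBilin' (Matrix.of R)
  have hB (f) : ∑ i, flowResidue Γ.dir R f i * Γ.dir f i = B (u f) (u f) := by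
    simp_rw [flowResidue, Finset.sum_mul]
    rw [Finset.sum_comm]
    simp [B, u, Matrix.toBilin'_apply]
  have hleaf {f j} (hf : Γ.dir f = Pi.single j 1) : B (u f) (u f) = R j j := by
    simp [B, u, hf, Matrix.toBilin'_apply, Pi.single_apply]
  have hopp (f) (hf : Γ.opp f ≠ f) : u (Γ.opp f) = -u f := by
    ext i
    simp [u, Γ.dir_opp f hf]
  have hdown (v) : u (φ v).down = -(u (φ v).left + u (φ v).right) := by
    ext i
    simp [u, (φ v).dir_down_eq_neg]
  have hacross (v) : ∑ i ∈ (φ v).K, ∑ j ∈ (φ v).L, (R i j + R j i) =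
      B (u (φ v).left) (u (φ v).right) + B (u (φ v).right) (u (φ v).left) := by
    simp_rw [Finset.sum_add_distrib]
    rw [Finset.sum_comm (s := (φ v).K) (f := fun i j => R j i)]
    simp [B, u, Matrix.toBilin'_apply, (φ v).dir_left, (φ v).dir_right]
  have hquad (v) : B (u (φ v).down) (u (φ v).down) = B (u (φ v).left) (u (φ v).left) +
      B (u (φ v).right) (u (φ v).right) + ∑ i ∈ (φ v).K, ∑ j ∈ (φ v).L, (R i j + R j i) := by
    rw [hacross, hdown]
    simp only [map_neg, map_add, LinearMap.neg_apply, LinearMap.add_apply]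
    ring
  simp_rw [hB]
  refine ⟨fun h => ⟨fun j => hleaf (hdir j) ▸ h _, fun v => ?_⟩, fun ⟨hdiag, hcross⟩ f => ?_⟩
  · simpa [h, eq_comm] using hquad v
  · induction f using flag_induction himg φ with
    | leaf f j _ hf => rw [hleaf hf, hdiag]
    | opp f hf ih => simpa [hopp f hf] using ih
    | down v hl hr => rw [hquad, hl, hr, hcross, add_zero, add_zero]

end Linear

section Leaves

omit [Fintype V] [Fintype F] in
lemma update_dist_mem_minTwiceLocus (hsymm : ∀ i j, d i j = d j i)
    (hultra : ∀ i j k, i ≠ j → j ≠ k → i ≠ k → MinAttainedTwice (d i j) (d k j) (d i k))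
    {j : Fin n} {h : ℝ} (hh : ∀ i, d i j ≤ h) :
    Function.update (fun i => d i j) j h ∈ minTwiceLocus d := by
  intro i k hik
  rcases eq_or_ne i j with rfl | hij
  · rw [Function.update_self, Function.update_of_ne hik.symm]
    exact Or.inr (Or.inr ⟨hsymm k i, hh k⟩)
  rcases eq_or_ne k j with rfl | hkj
  · rw [Function.update_self, Function.update_of_ne hij]
    exact Or.inr (Or.inl ⟨rfl, hh i⟩)
  · rw [Function.update_of_ne hij, Function.update_of_ne hkj]
    exact hultra i j k hij hkj.symm hik

lemma exists_leaf (himg : Γ.image = minTwiceLocus d) (hsymm : ∀ i j, d i j = d j i)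
    (hultra : ∀ i j k, i ≠ j → j ≠ k → i ≠ k → MinAttainedTwice (d i j) (d k j) (d i k))
    (j : Fin n) : ∃ f, Γ.opp f = f ∧ Γ.dir f = Pi.single j 1 := by
  obtain ⟨hd, hhd⟩ := (Set.finite_range fun i => d i j).bddAbove
  obtain ⟨hv, hhv⟩ := (Set.finite_range fun v => Γ.pos v j).bddAbove
  set h : ℝ := max hd hv + 1
  have hdist (i) : d i j ≤ h := by linarith [hhd ⟨i, rfl⟩, le_max_left hd hv]
  have hpos (v) : Γ.pos v j < h := by linarith [hhv ⟨v, rfl⟩, le_max_right hd hv]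
  have hmem := himg ▸ update_dist_mem_minTwiceLocus hsymm hultra hdist
  rcases hmem with ⟨v, hv⟩ | hmem
  · exact absurd (hpos v) (by simp [hv])
  obtain ⟨f, s, hs, hlen, hx⟩ := Set.mem_iUnion.mp hmem
  have hxj : h = Γ.pos (Γ.vert f) j + s * Γ.dir f j := by simpa using hx j
  have hdir : (0 : ℝ) < Γ.dir f j :=
    pos_of_mul_pos_right (by linarith [hpos (Γ.vert f)]) hs.le
  have hf : Γ.opp f = f := by
    by_contra hf
    have := mul_lt_mul_of_pos_right (hlen hf) hdir
    linarith [hpos (Γ.vert (Γ.opp f)), Γ.pos_opp f hf j]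
  exact ⟨f, hf, dir_eq_single_of_unbounded himg hf (by exact_mod_cast hdir)⟩

end Leaves

end TropicalCurve

open Filter Topology Asymptotics

section Perturbation

/-- The isomorphism `x ↦ x - B (A B)⁻¹ A x` from the kernel of `A₀` to the kernel of `A`, for a
right inverse `B` of `A₀` and the inverse `M⁻¹` of `A B`. Its inverse is `x ↦ x - B A₀ x`. -/
def kerEquivOfRightInverse {𝕜 E G : Type*} [Ring 𝕜] [AddCommGroup E] [Module 𝕜 E]
    [AddCommGroup G] [Module 𝕜 G] {A₀ A : E →ₗ[𝕜] G} {B : G →ₗ[𝕜] E} (hB : A₀ ∘ₗ B = .id)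
    (M : G ≃ₗ[𝕜] G) (hM : A ∘ₗ B = M) : LinearMap.ker A₀ ≃ₗ[𝕜] LinearMap.ker A :=
  have hB (y) : A₀ (B y) = y := LinearMap.congr_fun hB y
  have hM (y) : A (B y) = M y := LinearMap.congr_fun hM y
  .ofLinearMap
    ((LinearMap.id - B ∘ₗ M.symm ∘ₗ A).restrict fun x _ => by simp [hM])
    ((LinearMap.id - B ∘ₗ A₀).restrict fun x _ => by simp [hB])
    (by
      ext x
      have hx : A x = 0 := x.2
      simp [LinearMap.restrict_apply, hx, hM])
    (by
      ext x
      have hx : A₀ x = 0 := x.2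
      simp [LinearMap.restrict_apply, hx, hB])

variable {𝕜 E G : Type*} [NontriviallyNormedField 𝕜] [NormedAddCommGroup E] [NormedSpace 𝕜 E]
  [NormedAddCommGroup G] [NormedSpace 𝕜 G]

lemma norm_le_two_mul_norm_apply {T : G →L[𝕜] G} (hT : ‖T - .id 𝕜 G‖ ≤ 1 / 2) (y : G) :
    ‖y‖ ≤ 2 * ‖T y‖ := by
  have hy : ‖T y - y‖ ≤ 1 / 2 * ‖y‖ :=
    ((T - .id 𝕜 G).le_opNorm y).trans (by gcongr)
  linarith [norm_le_norm_add_norm_sub' y (T y), norm_sub_rev y (T y)]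

variable [FiniteDimensional 𝕜 G]

lemma exists_ker_equiv_norm_sub_le {A₀ A : E →L[𝕜] G} {B : G →L[𝕜] E} (hB : A₀ ∘L B = .id 𝕜 G)
    (hA : ‖A - A₀‖ * ‖B‖ ≤ 1 / 2) : ∃ Φ : A₀.ker ≃ₗ[𝕜] A.ker,
      ∀ x, ‖(Φ x : E) - x‖ ≤ 2 * ‖B‖ * ‖A - A₀‖ * ‖(x : E)‖ := by
  have hAB : ‖A ∘L B - .id 𝕜 G‖ ≤ 1 / 2 := by
    rw [← hB, ← ContinuousLinearMap.sub_comp]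
    exact (ContinuousLinearMap.opNorm_comp_le _ _).trans hA
  have hinj : Function.Injective (A ∘L B : G →ₗ[𝕜] G) :=
    (injective_iff_map_eq_zero _).mpr fun y hy => norm_le_zero_iff.mp <|
      (norm_le_two_mul_norm_apply hAB y).trans_eq <| by
        rw [← ContinuousLinearMap.coe_coe, hy, norm_zero, mul_zero]
  let M := LinearEquiv.ofInjectiveEndo _ hinj
  refine ⟨kerEquivOfRightInverse (congrArg ContinuousLinearMap.toLinearMap hB) M rfl,
    fun x => ?_⟩
  have hx : A x = (A - A₀) x := by
    have : A₀ x = 0 := x.2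
    simp [this]
  calc ‖(x : E) - B (M.symm (A x)) - x‖ = ‖B (M.symm (A x))‖ := by
        rw [sub_sub_cancel_left, norm_neg]
    _ ≤ ‖B‖ * ‖M.symm (A x)‖ := B.le_opNorm _
    _ ≤ ‖B‖ * (2 * ‖M (M.symm (A x))‖) := by
        gcongr
        exact norm_le_two_mul_norm_apply hAB _
    _ = ‖B‖ * (2 * ‖(A - A₀) x‖) := by rw [M.apply_symm_apply, hx]
    _ ≤ ‖B‖ * (2 * (‖A - A₀‖ * ‖(x : E)‖)) := by
        gcongr
        exact (A - A₀).le_opNorm _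
    _ = _ := by ring

variable {T S : Type*} [NormedAddCommGroup S] {l : Filter T} {u : T → S}

variable [CompleteSpace 𝕜] [FiniteDimensional 𝕜 E]

omit [FiniteDimensional 𝕜 G] in
lemma isBigO_of_forall_apply {A : T → E →L[𝕜] G} (h : ∀ x, (fun t => A t x) =O[l] u) :
    A =O[l] u := by
  let b := Module.finBasis 𝕜 E
  obtain ⟨C, -, hC⟩ := b.exists_opNorm_le (F := G)
  exact (IsBigO.of_bound C (.of_forall fun t => hC (norm_nonneg fun i => A t (b i))
    fun i => norm_le_pi_norm (fun i => A t (b i)) i)).trans (isBigO_pi.mpr fun i => h (b i))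

lemma exists_eventually_ker_equiv {A₀ : E →ₗ[𝕜] G} (hA₀ : Function.Surjective A₀)
    {A : T → E →ₗ[𝕜] G} (hu : Tendsto u l (𝓝 0))
    (hA : ∀ x, (fun t => A t x - A₀ x) =O[l] u) :
    ∃ C, ∀ᶠ t in l, ∃ Φ : LinearMap.ker A₀ ≃ₗ[𝕜] LinearMap.ker (A t),
      ∀ x, ‖(Φ x : E) - x‖ ≤ C * ‖u t‖ * ‖(x : E)‖ := by
  obtain ⟨B, hB⟩ := A₀.exists_rightInverse_of_surjective (LinearMap.range_eq_top.mpr hA₀)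
  let A₀' := A₀.toContinuousLinearMap
  let B' := B.toContinuousLinearMap
  let A' := fun t => (A t).toContinuousLinearMap
  have hB' : A₀' ∘L B' = .id 𝕜 G := ContinuousLinearMap.coe_injective hB
  have hA' : (fun t => A' t - A₀') =O[l] u := isBigO_of_forall_apply hA
  have hsmall : Tendsto (fun t => ‖A' t - A₀'‖ * ‖B'‖) l (𝓝 0) := by
    simpa using (tendsto_zero_iff_norm_tendsto_zero.mp (hA'.trans_tendsto hu)).mul_const ‖B'‖
  obtain ⟨C, hC⟩ := hA'.bound
  refine ⟨2 * ‖B'‖ * C, ?_⟩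
  filter_upwards [hC, hsmall.eventually_le_const one_half_pos] with t hCt hsmallt
  obtain ⟨Φ, hΦ⟩ := exists_ker_equiv_norm_sub_le hB' hsmallt
  refine ⟨Φ, fun x => (hΦ x).trans ?_⟩
  rw [mul_assoc _ C]
  gcongr

end Perturbation

section Conditions

variable {n : ℕ} {V F : Type*} [Fintype V] [Fintype F] {Γ : TropicalCurve n V F}
  {d : Fin n → Fin n → ℝ}

/-- The diagonal entries of a matrix of residues, and for each vertex the sum of the symmetrized
entries with one index in the left branch and one index outside of it, with weights `a`. Sections
over both curves are the kernels of such maps: see `mem_ker_lineWeight_iff` and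
`mem_ker_limitWeight_iff`. -/
def conditionMap (φ : ∀ v, Γ.Fork d v) (a : V → Fin n → Fin n → ℂ) :
    (Fin n → Fin n → ℂ) →ₗ[ℂ] Fin n ⊕ V → ℂ :=
  let entry (i j : Fin n) : (Fin n → Fin n → ℂ) →ₗ[ℂ] ℂ :=
    LinearMap.proj (φ := fun _ => ℂ) j ∘ₗ LinearMap.proj i
  LinearMap.pi <| Sum.elim (fun j => entry j j)
    fun v => ∑ j ∈ (φ v).K, ∑ i ∈ (φ v).Kᶜ, a v j i • (entry i j + entry j i)

variable (φ : ∀ v, Γ.Fork d v) (a : V → Fin n → Fin n → ℂ) (R : Fin n → Fin n → ℂ)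

lemma conditionMap_inl (j : Fin n) : conditionMap φ a R (.inl j) = R j j := rfl

lemma conditionMap_inr (v : V) : conditionMap φ a R (.inr v) =
    ∑ j ∈ (φ v).K, ∑ i ∈ (φ v).Kᶜ, a v j i * (R i j + R j i) := by
  simp [conditionMap, mul_add]

lemma mem_ker_conditionMap_iff : R ∈ LinearMap.ker (conditionMap φ a) ↔
    (∀ j, R j j = 0) ∧ ∀ v, conditionMap φ a R (.inr v) = 0 := by
  rw [LinearMap.mem_ker, funext_iff, Sum.forall]
  rfl

/-- The weights for the line with the marked points `a`, normalized to be `1` at the pair of the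
ends chosen in the two branches. -/
def lineWeight (a : Fin n → ℂ) (v : V) (j i : Fin n) : ℂ :=
  (a (φ v).k - a (φ v).l) / (a j - a i)

/-- The limit of `lineWeight`: only the pairs across the two branches at a vertex count. -/
def limitWeight (v : V) (_ i : Fin n) : ℂ := if i ∈ (φ v).L then 1 else 0

lemma conditionMap_lineWeight_inr (a : Fin n → ℂ) (v : V) :
    conditionMap φ (lineWeight φ a) R (.inr v) =
      (a (φ v).k - a (φ v).l) * ∑ j ∈ (φ v).K, simpleResidue a R j := by
  simp_rw [conditionMap_inr, sum_simpleResidue, Finset.mul_sum, lineWeight]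
  congr! 2
  ring

lemma conditionMap_limitWeight_inr (v : V) : conditionMap φ (limitWeight φ) R (.inr v) =
    ∑ i ∈ (φ v).K, ∑ j ∈ (φ v).L, (R i j + R j i) := by
  have hL : (φ v).L ⊆ (φ v).Kᶜ := fun i hi => by simpa using (φ v).notMem_left hi
  simp [conditionMap_inr, limitWeight, ite_mul, Finset.inter_eq_right.mpr hL, add_comm]

section Kernels

variable (himg : Γ.image = minTwiceLocus d) {leaf : Fin n → F}
  (hdir : ∀ j, Γ.dir (leaf j) = Pi.single j 1)
include himg hdir

lemma mem_ker_limitWeight_iff : R ∈ LinearMap.ker (conditionMap φ (limitWeight φ)) ↔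
    ∀ f, ∑ i, flowResidue Γ.dir R f i * Γ.dir f i = 0 := by
  simp_rw [mem_ker_conditionMap_iff, conditionMap_limitWeight_inr,
    TropicalCurve.sum_flowResidue_mul_dir_eq_zero_iff himg φ hdir]

lemma mem_ker_lineWeight_iff (hwt : ∀ f, Γ.wt f = 1) {a : Fin n → ℂ}
    (ha : Function.Injective a) : R ∈ LinearMap.ker (conditionMap φ (lineWeight φ a)) ↔
      (∀ j, R j j = 0) ∧ ∀ j, simpleResidue a R j = 0 := by
  have hkl (v) : a (φ v).k - a (φ v).l ≠ 0 := sub_ne_zero.mpr <| ha.ne fun h =>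
    (φ v).notMem_right (φ v).k_mem (h ▸ (φ v).l_mem)
  simp_rw [mem_ker_conditionMap_iff, conditionMap_lineWeight_inr, mul_eq_zero, hkl, false_or]
  refine and_congr_right fun _ => ⟨fun h => ?_, fun h v => Finset.sum_eq_zero fun j _ => h j⟩
  exact TropicalCurve.eq_zero_of_sum_left_eq_zero himg φ hwt hdir
    ((sum_simpleResidue a R Finset.univ).trans (by simp)) h

end Kernels

lemma conditionMap_limitWeight_single_inr (i j : Fin n) (v : V) :
    conditionMap φ (limitWeight φ) (fun a b => if a = i ∧ b = j then 1 else 0)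
      (.inr v) =
      (if i ∈ (φ v).K ∧ j ∈ (φ v).L then 1 else 0) +
        if i ∈ (φ v).L ∧ j ∈ (φ v).K then 1 else 0 := by
  rw [conditionMap_limitWeight_inr]
  have hsum (a b) : ∑ x ∈ (φ v).K, ∑ y ∈ (φ v).L, (if x = a ∧ y = b then (1 : ℂ) else 0) =
      if a ∈ (φ v).K ∧ b ∈ (φ v).L then 1 else 0 := by
    simp only [ite_and, Finset.sum_ite_irrel, Finset.sum_ite_eq', Finset.sum_const_zero]
  simp_rw [Finset.sum_add_distrib, hsum, and_comm (a := _ = i), and_comm (a := i ∈ _), hsum]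

lemma conditionMap_limitWeight_single_diag (j : Fin n) [DecidableEq V] :
    conditionMap φ (limitWeight φ) (fun a b => if a = j ∧ b = j then 1 else 0) =
      Pi.single (.inl j) 1 := by
  ext (i | v)
  · simp [conditionMap_inl, Pi.single_apply]
  · have hdisj : j ∈ (φ v).K → j ∉ (φ v).L := (φ v).notMem_right
    simp only [conditionMap_limitWeight_single_inr]
    grind

lemma conditionMap_limitWeight_single_ends (hemb : Γ.IsEmbedded)
    (himg : Γ.image = minTwiceLocus d) (v : V) [DecidableEq V] :
    conditionMap φ (limitWeight φ)
      (fun a b => if a = (φ v).k ∧ b = (φ v).l then 1 else 0) = Pi.single (.inr v) 1 := by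
  have hk : (φ v).k ∉ (φ v).L := (φ v).notMem_right (φ v).k_mem
  have hkl : (φ v).k ≠ (φ v).l := fun h => hk (h ▸ (φ v).l_mem)
  ext (j | w)
  · have hj : ¬(j = (φ v).k ∧ j = (φ v).l) := fun h => hkl (h.1.symm.trans h.2)
    simp [conditionMap_inl, hj]
  rw [conditionMap_limitWeight_single_inr]
  rcases eq_or_ne w v with rfl | hwv
  · simp [hk, (φ w).k_mem, (φ w).l_mem]
  · have hw (h) : w = v :=
      (φ w).vertex_unique hemb himg (φ v) h (.inl ⟨(φ v).k_mem, (φ v).l_mem⟩)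
    rw [if_neg fun h => hwv (hw (.inl h)), if_neg fun h => hwv (hw (.inr h))]
    simp [hwv]

lemma conditionMap_limitWeight_surjective (hemb : Γ.IsEmbedded)
    (himg : Γ.image = minTwiceLocus d) :
    Function.Surjective (conditionMap φ (limitWeight φ)) := by
  classical
  rw [← LinearMap.range_eq_top, ← top_le_iff, ← (Pi.basisFun ℂ (Fin n ⊕ V)).span_eq,
    Submodule.span_le, Set.range_subset_iff]
  rintro (j | v) <;> rw [Pi.basisFun_apply]
  exacts [⟨_, conditionMap_limitWeight_single_diag φ j⟩,
    ⟨_, conditionMap_limitWeight_single_ends φ hemb himg v⟩]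

end Conditions

section Values

variable {p q : LaurentSeries ℂ} {m : ℤ} {a : ℂ}

lemma eventually_punctured_iff {P : ℂ → Prop} :
    (∀ᶠ t in 𝓝[≠] 0, P t) ↔ ∃ ε > 0, ∀ t : ℂ, 0 < ‖t‖ → ‖t‖ < ε → P t := by
  simp_rw [eventually_nhdsWithin_iff, Metric.eventually_nhds_iff, dist_zero_right,
    Set.mem_compl_singleton_iff, norm_pos_iff]
  exact exists_congr fun ε => and_congr_right fun _ => forall_congr' fun t => forall_comm

lemma Converges.eventually_summable (hq : Converges q) :
    ∀ᶠ t in 𝓝[≠] (0 : ℂ), Summable fun k : ℤ => q.coeff k * t ^ k :=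
  eventually_punctured_iff.mpr hq

lemma Converges.sub (hp : Converges p) (hq : Converges q) : Converges (p - q) :=
  eventually_punctured_iff.mp <| by
    filter_upwards [hp.eventually_summable, hq.eventually_summable] with t hpt hqt
    simpa [sub_mul] using hpt.sub hqt

lemma Converges.value_sub_eventuallyEq (hp : Converges p) (hq : Converges q) :
    value (p - q) =ᶠ[𝓝[≠] 0] fun t => value p t - value q t := by
  filter_upwards [hp.eventually_summable, hq.eventually_summable] with t hpt hqt
  simp only [value, HahnSeries.coeff_sub, sub_mul, hpt.tsum_sub hqt]

lemma hasSum_value_single (t : ℂ) :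
    HasSum (fun k => (HahnSeries.single m a).coeff k * t ^ k) (a * t ^ m) := by
  simpa using hasSum_single (f := fun k => (HahnSeries.single m a).coeff k * t ^ k) m
    fun k hk => by simp [hk]

lemma Converges.value_isBigO (hq : Converges q) (hm : q ∈ vanishBelow m) :
    value q =O[𝓝[≠] 0] fun t => t ^ m := by
  obtain ⟨ε, hε, hsum⟩ := hq
  obtain ⟨δ, hδ, hδε⟩ := exists_between hε
  have hnorm : ‖(δ : ℂ)‖ = δ := by simp [abs_of_pos hδ]
  let M := ∑' k : ℤ, ‖q.coeff k * (δ : ℂ) ^ k‖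
  have hM : Summable fun k : ℤ => ‖q.coeff k * (δ : ℂ) ^ k‖ :=
    (hsum δ (by rwa [hnorm]) (by rwa [hnorm])).norm
  refine IsBigO.of_bound (M * (δ ^ m)⁻¹) <| eventually_punctured_iff.mpr
    ⟨δ, hδ, fun t ht0 ht => ?_⟩
  have hle (k : ℤ) : ‖q.coeff k * t ^ k‖ ≤ ‖q.coeff k * (δ : ℂ) ^ k‖ * (‖t‖ / δ) ^ m := by
    rcases lt_or_ge k m with hk | hk
    · simp [hm k hk]
    · have hpow : (‖t‖ / δ) ^ k ≤ (‖t‖ / δ) ^ m :=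
        zpow_le_zpow_right_of_le_one₀ (by positivity) ((div_le_one hδ).mpr ht.le) hk
      calc ‖q.coeff k * t ^ k‖ = ‖q.coeff k * (δ : ℂ) ^ k‖ * (‖t‖ / δ) ^ k := by
            rw [norm_mul, norm_mul, norm_zpow, norm_zpow, hnorm, div_zpow]
            field_simp
        _ ≤ _ := by gcongr
  calc ‖value q t‖ ≤ M * (‖t‖ / δ) ^ m := tsum_of_norm_bounded (hM.hasSum.mul_right _) hle
    _ = M * (δ ^ m)⁻¹ * ‖t ^ m‖ := by
        rw [norm_zpow, div_zpow]
        ring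

lemma zpow_add_one_isLittleO (m : ℤ) :
    (fun t : ℂ => t ^ (m + 1)) =o[𝓝[≠] 0] fun t => t ^ m := by
  have hid : (fun t : ℂ => t) =o[𝓝[≠] 0] fun _ => (1 : ℂ) :=
    (isLittleO_one_iff ℂ).mpr (tendsto_id.mono_left nhdsWithin_le_nhds)
  refine ((isBigO_refl (fun t : ℂ => t ^ m) _).mul_isLittleO hid).congr' ?_ (by simp)
  filter_upwards [self_mem_nhdsWithin] with t ht
  rw [zpow_add_one₀ ht]

lemma Converges.value_isEquivalent (hq : Converges q) (hq0 : q ≠ 0) :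
    value q ~[𝓝[≠] 0] fun t => q.coeff q.order * t ^ q.order := by
  have hc : q.coeff q.order ≠ 0 := HahnSeries.coeff_order_eq_zero.not.mpr hq0
  have hlead : Converges (HahnSeries.single q.order (q.coeff q.order)) :=
    ⟨1, one_pos, fun t _ _ => (hasSum_value_single t).summable⟩
  have hrest := (hq.sub hlead).value_isBigO
    (sub_single_mem_vanishBelow (mem_vanishBelow_of_le_order le_rfl))
  refine (hrest.trans_isLittleO ((zpow_add_one_isLittleO _).const_mul_right hc)).congr' ?_ .rfl
  filter_upwards [hq.value_sub_eventuallyEq hlead] with t ht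
  rw [ht, value, value, (hasSum_value_single t).tsum_eq, Pi.sub_apply, value]

lemma Converges.eventually_value_ne_zero (hq : Converges q) (hq0 : q ≠ 0) :
    ∀ᶠ t in 𝓝[≠] 0, value q t ≠ 0 := by
  have hc : q.coeff q.order ≠ 0 := HahnSeries.coeff_order_eq_zero.not.mpr hq0
  filter_upwards [(hq.value_isEquivalent hq0).symm.isBigO.eq_zero_imp, self_mem_nhdsWithin]
    with t h ht hval
  exact mul_ne_zero hc (zpow_ne_zero _ ht) (h hval)

lemma Converges.value_div_isBigO (hp : Converges p) (hq : Converges q) (hq0 : q ≠ 0)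
    (hpq : p ∈ vanishBelow (q.order + 1)) :
    (fun t => value p t / value q t) =O[𝓝[≠] 0] fun t => t := by
  have hc : q.coeff q.order ≠ 0 := HahnSeries.coeff_order_eq_zero.not.mpr hq0
  have hlower : (fun t => t ^ q.order) =O[𝓝[≠] 0] value q :=
    (isBigO_const_mul_left_iff hc).mp (hq.value_isEquivalent hq0).symm.isBigO
  have hinv := hlower.inv_rev <| by
    filter_upwards [self_mem_nhdsWithin] with t ht h using absurd h (zpow_ne_zero _ ht)
  refine ((hp.value_isBigO hpq).mul hinv).congr' ?_ ?_
  · exact .of_forall fun t => (div_eq_mul_inv _ _).symm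
  · filter_upwards [self_mem_nhdsWithin] with t ht
    rw [zpow_add_one₀ ht, mul_right_comm, mul_inv_cancel₀ (zpow_ne_zero _ ht), one_mul]

end Values

section Differences

variable {n : ℕ} {p : Fin n → LaurentSeries ℂ} {i j : Fin n} {m : ℤ}

/-- The exponents `d (p_i - p_j)`, which describe the tropicalization of the line. -/
def diffOrder (p : Fin n → LaurentSeries ℂ) (i j : Fin n) : ℝ := (p i - p j).order

lemma tropLine_eq : tropLine p = minTwiceLocus (diffOrder p) := rfl

lemma diffOrder_symm (i j : Fin n) : diffOrder p i j = diffOrder p j i := by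
  rw [diffOrder, diffOrder, ← HahnSeries.order_neg, neg_sub]

lemma min_diffOrder_le (hinj : Function.Injective p) {i k : Fin n} (hik : i ≠ k) (j : Fin n) :
    min (diffOrder p i j) (diffOrder p j k) ≤ diffOrder p i k := by
  have hsum : p i - p j + (p j - p k) = p i - p k := sub_add_sub_cancel _ _ _
  have hle := HahnSeries.min_order_le_order_add (hsum ▸ sub_ne_zero.mpr (hinj.ne hik))
  rw [hsum] at hle
  unfold diffOrder
  exact_mod_cast hle

lemma diffOrder_ultrametric (hinj : Function.Injective p) (i j k : Fin n) (hij : i ≠ j)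
    (hjk : j ≠ k) (hik : i ≠ k) :
    MinAttainedTwice (diffOrder p i j) (diffOrder p k j) (diffOrder p i k) := by
  have hij := min_diffOrder_le hinj hij k
  have hjk := min_diffOrder_le hinj hjk i
  have hik := min_diffOrder_le hinj hik j
  simp only [MinAttainedTwice, min_le_iff, diffOrder_symm k j, diffOrder_symm j i] at *
  grind

lemma injective_of_prec (hord : ∀ i j, i < j → Prec (p i) (p j)) : Function.Injective p :=
  .of_lt_imp_ne fun i j hij h => by
    obtain ⟨k, -, hk, hk0⟩ := hord i j hij
    exact hk (h ▸ hk0)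

lemma eventually_injective_value (hconv : ∀ i, Converges (p i)) (hinj : Function.Injective p) :
    ∀ᶠ t in 𝓝[≠] (0 : ℂ), Function.Injective fun i => value (p i) t := by
  have hne (i j) : ∀ᶠ t in 𝓝[≠] (0 : ℂ), i ≠ j → value (p i) t ≠ value (p j) t := by
    rw [eventually_imp_distrib_left]
    intro hij
    filter_upwards [((hconv i).sub (hconv j)).eventually_value_ne_zero
      (sub_ne_zero.mpr (hinj.ne hij)), (hconv i).value_sub_eventuallyEq (hconv j)] with t h0 hsub
    exact sub_ne_zero.mp (hsub ▸ h0)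
  filter_upwards [eventually_all.mpr fun i => eventually_all.mpr (hne i)] with t ht i j
  exact not_imp_not.mp (ht i j)

lemma sub_mem_vanishBelow (h : i ≠ j → (m : ℝ) ≤ diffOrder p i j) : p i - p j ∈ vanishBelow m := by
  rcases eq_or_ne i j with rfl | hij
  · rw [sub_self]
    exact zero_mem _
  · exact mem_vanishBelow_of_le_order (by unfold diffOrder at h; exact_mod_cast h hij)

lemma sub_mem_vanishBelow_add_one {k l : Fin n} (h : i ≠ j → diffOrder p k l < diffOrder p i j) :
    p i - p j ∈ vanishBelow ((p k - p l).order + 1) :=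
  sub_mem_vanishBelow fun hij => by
    unfold diffOrder at h ⊢
    exact_mod_cast Int.add_one_le_of_lt (by exact_mod_cast h hij)

end Differences

section Weights

variable {n : ℕ} {V F : Type*} [Fintype V] [Fintype F] {Γ : TropicalCurve n V F}

lemma conditionMap_sub_isBigO {d : Fin n → Fin n → ℝ} (φ : ∀ v, Γ.Fork d v)
    {T : Type*} {l : Filter T} {u : T → ℂ} {a : T → V → Fin n → Fin n → ℂ}
    {b : V → Fin n → Fin n → ℂ}
    (h : ∀ v, ∀ j ∈ (φ v).K, ∀ i ∉ (φ v).K, (fun t => a t v j i - b v j i) =O[l] u)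
    (R : Fin n → Fin n → ℂ) :
    (fun t => conditionMap φ (a t) R - conditionMap φ b R) =O[l] u := by
  refine isBigO_pi.mpr ?_
  rintro (j | v)
  · simpa [conditionMap_inl] using isBigO_zero u l
  · simp_rw [Pi.sub_apply, conditionMap_inr, ← Finset.sum_sub_distrib, ← sub_mul]
    refine IsBigO.fun_sum fun j hj => IsBigO.fun_sum fun i hi => ?_
    simp_rw [mul_comm _ (R i j + R j i)]
    exact (h v j hj i (Finset.mem_compl.mp hi)).const_mul_left _

variable {p : Fin n → LaurentSeries ℂ} (hconv : ∀ i, Converges (p i))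
  (hinj : Function.Injective p) (φ : ∀ v, Γ.Fork (diffOrder p) v) {v : V} {i j : Fin n}
include hconv hinj

lemma lineWeight_isBigO_of_notMem (himg : Γ.image = minTwiceLocus (diffOrder p))
    (hj : j ∈ (φ v).K) (hiK : i ∉ (φ v).K) (hiL : i ∉ (φ v).L) :
    (fun t => lineWeight φ (fun i => value (p i) t) v j i) =O[𝓝[≠] 0] fun t => t := by
  have hk := (φ v).k_mem
  have hji : p j ≠ p i := hinj.ne fun h => hiK (h ▸ hj)
  have hdist : diffOrder p j i < diffOrder p (φ v).k (φ v).l := by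
    rw [(φ v).dist_of_across (.inl ⟨hk, (φ v).l_mem⟩), diffOrder_symm,
      eq_of_mem_argmax ((φ v).mem_argmax_of_mem (.inl hk)) ((φ v).mem_argmax_of_mem (.inl hj))]
    exact (φ v).dist_lt_of_outside himg hj hiK hiL
  refine (((hconv _).sub (hconv _)).value_div_isBigO ((hconv j).sub (hconv i))
    (sub_ne_zero.mpr hji) (sub_mem_vanishBelow_add_one fun _ => hdist)).congr' ?_ .rfl
  filter_upwards [(hconv (φ v).k).value_sub_eventuallyEq (hconv (φ v).l),
    (hconv j).value_sub_eventuallyEq (hconv i)] with t hkl hji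
  rw [hkl, hji, lineWeight]

lemma lineWeight_sub_one_isBigO (hj : j ∈ (φ v).K) (hi : i ∈ (φ v).L) :
    (fun t => lineWeight φ (fun i => value (p i) t) v j i - 1) =O[𝓝[≠] 0] fun t => t := by
  have hji : j ≠ i := fun h => (φ v).notMem_right hj (h ▸ hi)
  have hdist : diffOrder p j i = Γ.pos v j := (φ v).dist_of_across (.inl ⟨hj, hi⟩)
  have hwithin {K : Finset (Fin n)} {a b} (hK : IsBranch (diffOrder p) (Γ.pos v) K)
      (ha : a ∈ K) (hb : b ∈ K) :
      p a - p b ∈ vanishBelow ((p j - p i).order + 1) :=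
    sub_mem_vanishBelow_add_one fun hab => by
      rw [hdist, eq_of_mem_argmax ((φ v).mem_argmax_of_mem (.inl hj)) (hK.subset ha)]
      exact hK.dist_within _ ha _ hb hab
  let q := p (φ v).k - p j - (p (φ v).l - p i)
  have hq : q ∈ vanishBelow ((p j - p i).order + 1) :=
    sub_mem (hwithin (φ v).isBranch_left (φ v).k_mem hj)
      (hwithin (φ v).isBranch_right (φ v).l_mem hi)
  have hk := (hconv (φ v).k).sub (hconv j)
  have hl := (hconv (φ v).l).sub (hconv i)
  refine ((hk.sub hl).value_div_isBigO ((hconv j).sub (hconv i))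
    (sub_ne_zero.mpr (hinj.ne hji)) hq).congr' ?_ .rfl
  filter_upwards [hk.value_sub_eventuallyEq hl, (hconv _).value_sub_eventuallyEq (hconv j),
    (hconv _).value_sub_eventuallyEq (hconv i), (hconv j).value_sub_eventuallyEq (hconv i),
    eventually_injective_value hconv hinj] with t hsub hkj hli hjit ht
  have hne : value (p j) t - value (p i) t ≠ 0 := sub_ne_zero.mpr (ht.ne hji)
  rw [hsub, hkj, hli, hjit, lineWeight, div_sub_one hne]
  ring

lemma lineWeight_sub_limitWeight_isBigO (himg : Γ.image = minTwiceLocus (diffOrder p))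
    (hj : j ∈ (φ v).K) (hi : i ∉ (φ v).K) :
    (fun t => lineWeight φ (fun i => value (p i) t) v j i - limitWeight φ v j i)
      =O[𝓝[≠] 0] fun t => t := by
  by_cases hiL : i ∈ (φ v).L
  · simpa [limitWeight, hiL] using lineWeight_sub_one_isBigO hconv hinj φ hj hiL
  · simpa [limitWeight, hiL] using lineWeight_isBigO_of_notMem hconv hinj φ himg hj hi hiL

end Weights

section Comparison

lemma norm_flowResidue_sub_le {n : ℕ} {F : Type*} {dir : F → Fin n → ℤ} {f : F}
    (hdir : ∀ j, |dir f j| ≤ 1) (R R' : Fin n → Fin n → ℂ) (i : Fin n) :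
    ‖flowResidue dir R f i - flowResidue dir R' f i‖ ≤ n * ‖R - R'‖ := by
  have hterm (j) : ‖(dir f j : ℂ) * (R - R') j i‖ ≤ ‖R - R'‖ := by
    have hnorm : ‖(dir f j : ℂ)‖ ≤ 1 := by
      rw [Complex.norm_intCast]
      exact_mod_cast hdir j
    rw [norm_mul]
    exact (mul_le_of_le_one_left (norm_nonneg _) hnorm).trans
      ((norm_le_pi_norm ((R - R') j) i).trans (norm_le_pi_norm (R - R') j))
  calc ‖flowResidue dir R f i - flowResidue dir R' f i‖ =
        ‖∑ j, (dir f j : ℂ) * (R - R') j i‖ := by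
        simp [flowResidue, mul_sub]
    _ ≤ ∑ _j : Fin n, ‖R - R'‖ := norm_sum_le_of_le _ fun j _ => hterm j
    _ = n * ‖R - R'‖ := by simp

lemma abs_starDir_le_one {r : ℕ} (g : Option (Fin (r + 1))) (j : Fin (r + 1)) :
    |starDir r g j| ≤ 1 := by
  cases g with
  | none => simp [starDir]
  | some k => rcases eq_or_ne j k with rfl | h <;> simp [starDir, *]

variable {r : ℕ} {V F : Type*} [Fintype V] [Fintype F] {Γ : TropicalCurve (r + 1) V F}
  {d : Fin (r + 1) → Fin (r + 1) → ℝ}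

lemma exists_preLog_equiv (htri : Γ.IsTrivalent) (hemb : Γ.IsEmbedded) (hwt : ∀ f, Γ.wt f = 1)
    (himg : Γ.image = minTwiceLocus d) (φ : ∀ v, Γ.Fork d v) {leaf : Fin (r + 1) → F}
    (hleaf : ∀ j, Γ.opp (leaf j) = leaf j) (hdir : ∀ j, Γ.dir (leaf j) = Pi.single j 1)
    {D : ToricCurve (r + 1) Γ.toFlagGraph} (hD : D.IsPreLogOfType Γ) :
    ∃ Ψ : D.dualObstructionSections ≃ₗ[ℂ] LinearMap.ker (conditionMap φ (limitWeight φ)),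
      ∀ ω f i, residue (D.pt f) (ω.1 (Γ.vert f) i) = flowResidue Γ.dir (Ψ ω).1 f i := by
  have hframe := TropicalCurve.isFlowFrame hwt hemb himg φ hleaf hdir
  exact ToricCurve.exists_residue_equiv hD.componentPt_injective hframe _ fun R =>
    (mem_ker_limitWeight_iff φ R himg hdir).trans
      (hD.sum_formsOfResidues_mul_dlog_eq_zero_iff htri (hframe.isFlow_flowResidue R)).symm

lemma exists_lineCurve_equiv (hwt : ∀ f, Γ.wt f = 1) (himg : Γ.image = minTwiceLocus d)
    (φ : ∀ v, Γ.Fork d v) {leaf : Fin (r + 1) → F} (hdir : ∀ j, Γ.dir (leaf j) = Pi.single j 1)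
    {p : Fin (r + 1) → LaurentSeries ℂ} (hp0 : p 0 = 0) {t : ℂ}
    (ha : Function.Injective fun i => value (p i) t) :
    ∃ Ψ : (lineCurve p t).dualObstructionSections ≃ₗ[ℂ]
        LinearMap.ker (conditionMap φ (lineWeight φ fun i => value (p i) t)),
      ∀ ω g i, residue ((lineCurve p t).pt g) (ω.1 () i) =
        flowResidue (starDir r) (Ψ ω).1 g i :=
  ToricCurve.exists_residue_equiv (lineCurve_componentPt_injective ha) starGraph_isFlowFrame _
    fun R => (mem_ker_lineWeight_iff φ R himg hdir hwt ha).trans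
      (sum_lineCurve_formsOfResidues_eq_zero_iff hp0 ha R).symm

lemma exists_eventually_ker_conditionMap_equiv (hemb : Γ.IsEmbedded)
    {p : Fin (r + 1) → LaurentSeries ℂ} (hconv : ∀ i, Converges (p i))
    (hinj : Function.Injective p) (himg : Γ.image = minTwiceLocus (diffOrder p))
    (φ : ∀ v, Γ.Fork (diffOrder p) v) :
    ∃ C, ∀ᶠ t in 𝓝[≠] (0 : ℂ), ∃ Φ : LinearMap.ker (conditionMap φ (limitWeight φ)) ≃ₗ[ℂ]
        LinearMap.ker (conditionMap φ (lineWeight φ fun i => value (p i) t)),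
      ∀ R, ‖(Φ R).1 - R.1‖ ≤ C * ‖t‖ * ‖R.1‖ :=
  exists_eventually_ker_equiv (conditionMap_limitWeight_surjective φ hemb himg)
    (tendsto_id.mono_left nhdsWithin_le_nhds) <| conditionMap_sub_isBigO φ fun _ _ hj _ hi =>
      lineWeight_sub_limitWeight_isBigO hconv hinj φ himg hj hi

end Comparison

end TropLine

end

open TropLine

theorem proposition5p10_general (r : ℕ)
    (p : Fin (r + 1) → LaurentSeries ℂ) (hp0 : p 0 = 0)
    (hconv : ∀ i, TropLine.Converges (p i)) (hinj : Function.Injective p)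
    {V F : Type*} [Fintype V] [Fintype F]
    (Γ : TropLine.TropicalCurve (r + 1) V F)
    (hΓ3 : Γ.IsTrivalent) (hΓemb : Γ.IsEmbedded) (hΓwt : ∀ f, Γ.wt f = 1)
    (htrop : Γ.image = TropLine.tropLine p)
    (D : TropLine.ToricCurve (r + 1) Γ.toFlagGraph) (hD : D.IsPreLogOfType Γ) :
    ∃ ε : ℝ, 0 < ε ∧
      ∃ Θ : ∀ t : {t : ℂ // 0 < ‖t‖ ∧ ‖t‖ < ε},
          D.dualObstructionSections ≃ₗ[ℂ]
            (TropLine.lineCurve p (t : ℂ)).dualObstructionSections,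
        ∀ s : D.dualObstructionSections, ∃ K : ℝ,
          ∀ (t : {t : ℂ // 0 < ‖t‖ ∧ ‖t‖ < ε}) (f : F) (g : Option (Fin (r + 1))),
            Γ.opp f = f → Γ.dir f = TropLine.starDir r g →
            ∀ i, ‖TropLine.residue ((TropLine.lineCurve p (t : ℂ)).pt g)
                    ((Θ t s : Unit → Fin (r + 1) → RatFunc ℂ) () i) -
                  TropLine.residue (D.pt f)
                    ((s : V → Fin (r + 1) → RatFunc ℂ) (Γ.vert f) i)‖ ≤ K * ‖(t : ℂ)‖ := by
  have himg : Γ.image = minTwiceLocus (diffOrder p) := htrop.trans tropLine_eq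
  have φ (v) := (TropicalCurve.nonempty_fork hΓ3 hΓemb hΓwt himg v).some
  choose leaf hleaf hdir using
    TropicalCurve.exists_leaf himg diffOrder_symm (diffOrder_ultrametric hinj)
  obtain ⟨Ψ₀, hΨ₀⟩ := exists_preLog_equiv hΓ3 hΓemb hΓwt himg φ hleaf hdir hD
  obtain ⟨C, hC⟩ := exists_eventually_ker_conditionMap_equiv hΓemb hconv hinj himg φ
  obtain ⟨ε, hε, hsmall⟩ := eventually_punctured_iff.mp
    (hC.and (eventually_injective_value hconv hinj))
  choose Φ hΦ using fun t : {t : ℂ // 0 < ‖t‖ ∧ ‖t‖ < ε} => (hsmall t t.2.1 t.2.2).1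
  choose Ψ hΨ using fun t : {t : ℂ // 0 < ‖t‖ ∧ ‖t‖ < ε} =>
    exists_lineCurve_equiv hΓwt himg φ hdir hp0 (hsmall t t.2.1 t.2.2).2
  refine ⟨ε, hε, fun t => Ψ₀ ≪≫ₗ Φ t ≪≫ₗ (Ψ t).symm, fun s =>
    ⟨(r + 1 : ℕ) * (C * ‖(Ψ₀ s).1‖), fun t f g _ hfg i => ?_⟩⟩
  have hlimit : residue (D.pt f) (s.1 (Γ.vert f) i) = flowResidue (starDir r) (Ψ₀ s).1 g i := by
    rw [hΨ₀, flowResidue, flowResidue, hfg]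
  have hline := hΨ t ((Ψ t).symm (Φ t (Ψ₀ s))) g i
  rw [LinearEquiv.apply_symm_apply] at hline
  calc _ = ‖flowResidue (starDir r) (Φ t (Ψ₀ s)).1 g i - flowResidue (starDir r) (Ψ₀ s).1 g i‖ :=
        congrArg norm (congrArg₂ _ hline hlimit)
    _ ≤ (r + 1 : ℕ) * ‖(Φ t (Ψ₀ s)).1 - (Ψ₀ s).1‖ :=
        norm_flowResidue_sub_le (abs_starDir_le_one g) _ _ i
    _ ≤ (r + 1 : ℕ) * (C * ‖t.1‖ * ‖(Ψ₀ s).1‖) := by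
        gcongr
        exact hΦ t (Ψ₀ s)
    _ = _ := by ring

theorem proposition5p10 (r : ℕ) (hr : 1 ≤ r)
    (p : Fin (r + 1) → LaurentSeries ℂ) (hp0 : p 0 = 0)
    (hconv : ∀ i, TropLine.Converges (p i))
    (hord : ∀ i j, i < j → TropLine.Prec (p i) (p j))
    {V F : Type*} [Fintype V] [Fintype F]
    (Γ : TropLine.TropicalCurve (r + 1) V F)
    (hΓ3 : Γ.IsTrivalent) (hΓemb : Γ.IsEmbedded) (hΓwt : ∀ f, Γ.wt f = 1)
    (htrop : Γ.image = TropLine.tropLine p)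
    (D : TropLine.ToricCurve (r + 1) Γ.toFlagGraph) (hD : D.IsPreLogOfType Γ) :
    ∃ ε : ℝ, 0 < ε ∧
      ∃ Θ : ∀ t : {t : ℂ // 0 < ‖t‖ ∧ ‖t‖ < ε},
          D.dualObstructionSections ≃ₗ[ℂ]
            (TropLine.lineCurve p (t : ℂ)).dualObstructionSections,
        ∀ s : D.dualObstructionSections, ∃ K : ℝ,
          ∀ (t : {t : ℂ // 0 < ‖t‖ ∧ ‖t‖ < ε}) (f : F) (g : Option (Fin (r + 1))),
            Γ.opp f = f → Γ.dir f = TropLine.starDir r g →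
            ∀ i, ‖TropLine.residue ((TropLine.lineCurve p (t : ℂ)).pt g)
                    ((Θ t s : Unit → Fin (r + 1) → RatFunc ℂ) () i) -
                  TropLine.residue (D.pt f)
                    ((s : V → Fin (r + 1) → RatFunc ℂ) (Γ.vert f) i)‖ ≤ K * ‖(t : ℂ)‖ :=
  proposition5p10_general r p hp0 hconv (injective_of_prec hord) Γ hΓ3 hΓemb hΓwt htrop D hD
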